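/- Conventions. Let $\mathbb P$ be the positive integers, $[n]=\{1,\dots,n\}$, and let $(i,j)$ denote the lattice point in row $i$ (rows numbered downwards) and column $j$ (columns numbered rightwards). *Paths.* For $a,b\in\mathbb P$ and $\alpha=\{\alpha_1<\dots<\alpha_r\}\subseteq[a]$, $\beta=\{\beta_1<\dots<\beta_r\}\subseteq[b]$, let $\mathrm{OP}(a,b,\alpha,\beta)$ be the set of $r$-tuples $P=(P_1,\dots,P_r)$ of lattice paths, $P_k$ going from $(a,\beta_k)$ to $(\alpha_k,b)$ by steps $(0,1)$ and $(-1,0)$, such that $P_k$ and $P_{k+1}$ are osculating for every $k$: at each common point $P_k$ arrives from the left and leaves upwards, while $P_{k+1}$ arrives from below (unless it starts there) and leaves to the right (unless it ends there). Let $Z(P)$ be the set of points of $[a]\times[b]$ through which no path or two paths of $P$ pass, and $\mathrm{VOS}(a,b,\alpha,\beta,l)=\{Z(P) : P\in\mathrm{OP}(a,b,\alpha,\beta),\ |Z(P)|=l\}$. *Partitions.* Let $\lambda$ be a partition with length $\ell(\lambda)\le a$ and largest part $\lambda_1\le b$ (with $\lambda_1=0$ if $\lambda=\emptyset$), and let $(\gamma_1,\dots,\gamma_r\,|\,\delta_1,\dots,\delta_r)$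 be the Frobenius notation of its complement $(b-\lambda_a,\dots,b-\lambda_1)$ in the $a\times b$ rectangle. The boundary pair corresponding to $\lambda$ is $\alpha_{a,b,\lambda}=\{a-\delta_1,\dots,a-\delta_r\}$, $\beta_{a,b,\lambda}=\{b-\gamma_1,\dots,b-\gamma_r\}$. *Tableaux.* $\mathrm{OT}(\lambda,l)$ is the set of oscillating tableaux $\eta=(\eta_0=\emptyset,\eta_1,\dots,\eta_l=\lambda)$ of shape $\lambda$ and length $l$: sequences of partitions in which the Young diagrams of $\eta_{k-1}$ and $\eta_k$ differ by exactly one square. Let $\Omega(\eta)_k$ be the content (column minus row) of that square. For a total strict order $\prec$ on $\mathbb Z$, an ascent of $\eta$ is a $k\in[l-1]$ with $\Omega(\eta)_k\prec\Omega(\eta)_{k+1}$. For $T\subseteq\mathbb P$, $\mathrm{GOT}(T,\prec,\lambda,l)$ is the set of pairs $(t,\eta)\in T^l\times\mathrm{OT}(\lambda,l)$ such that, for each $k\in[l-1]$, either $t_k<t_{k+1}$, or $t_k=t_{k+1}$ and $k$ is an ascent of $\eta$. *Mappings.* For $q\in\mathbb Z$, a $q$-order is a total strict order $\prec_q$ on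 $\mathbb Z$ such that $z\prec_q z'$ whenever $z<z'\le q$ or $z>z'\ge q$. Put $L_q(i,j)=\max(i+q,j)$ if $q\le0$ and $L_q(i,j)=\max(i,j-q)$ if $q\ge0$. For $u,z\in\mathbb Z$ let $G_q(u,z)$ be the unique $(i,j)\in\mathbb Z^2$ with $L_q(i,j)=u$ and $j-i=z$, and put $\Phi_q(t,\eta)=\{G_q(t_1,\Omega(\eta)_1),\dots,G_q(t_l,\Omega(\eta)_l)\}$. For a vacancy-osculation set $S$ with $l$ elements, let $s_1,\dots,s_l$, $s_k=(i_k,j_k)$, be the ordering of $S$ in which, for each $k\in[l-1]$, $L_q(s_k)<L_q(s_{k+1})$, or $L_q(s_k)=L_q(s_{k+1})$ and $j_k-i_k\prec_q j_{k+1}-i_{k+1}$ (if $k<m$ then $i_k<i_m$ or $j_k<j_m$ in this ordering), let $\eta(s)$ be the unique oscillating tableau with $\Omega(\eta(s))_k=j_k-i_k$ for all $k$, and put $\Theta_{(L_q,\prec_q)}(S)=((L_q(s_1),\dots,L_q(s_l)),\eta(s))$. **Theorem.** Let $n\in\mathbb P$, $q\in\mathbb Z$, let $\prec_q$ be a $q$-order,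 $\lambda$ a partition and $l\ge0$ an integer. (i) If $n<L_q(\ell(\lambda),\lambda_1)$, then $\mathrm{GOT}([n],\prec_q,\lambda,l)$ is empty. (ii) If $n\ge L_q(\ell(\lambda),\lambda_1)$, put $a=\max(n,n-q)$ and $b=\max(n,n+q)$. Then $\ell(\lambda)\le a$ and $\lambda_1\le b$, the pair $(\alpha,\beta)=(\alpha_{a,b,\lambda},\beta_{a,b,\lambda})$ is well defined (with $\alpha\subseteq[a]$, $\beta\subseteq[b]$, $|\alpha|=|\beta|$), and $\Phi_q$ is a bijection from $\mathrm{GOT}([n],\prec_q,\lambda,l)$ to $\mathrm{VOS}(a,b,\alpha,\beta,l)$, on which $\Theta_{(L_q,\prec_q)}$ is well defined and is the inverse mapping. (iii) Consequently, $\mathrm{OT}(\lambda,l)$ being finite, the distribution of the number of ascents does not depend on the $q$-order: if $\prec_q$ and $\prec_q'$ are $q$-orders for the same $q$, then for every $i\ge0$ the number of $\eta\in\mathrm{OT}(\lambda,l)$ with exactly $i$ ascents is the same with respect to $\prec_q$ and to $\prec_q'$. -/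

import Mathlib

namespace Osculating

/-- Lattice points, written `(row, column)`; rows are numbered downwards, columns rightwards. -/
abbrev Point := ℤ × ℤ

/-- The content (diagonal) `j - i` of a lattice point. -/
def content (v : Point) : ℤ := v.2 - v.1

/-- The rectangle `[a] × [b]`. -/
noncomputable def rect (a b : ℕ) : Finset Point := Finset.Icc 1 (a : ℤ) ×ˢ Finset.Icc 1 (b : ℤ)

/-! ### Tuples of osculating paths -/

/-- One unit step, to the right `(0,1)` or upwards `(-1,0)`. -/
def Step (v w : Point) : Prop := w - v = (0, 1) ∨ w - v = (-1, 0)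

/-- The set of all lattice paths from `(a, y)` to `(x, b)`. -/
def latticePaths (a b : ℕ) (x y : ℤ) : Set (List Point) :=
  {p | p.head? = some ((a : ℤ), y) ∧ p.getLast? = some (x, (b : ℤ)) ∧ p.IsChain Step}

/-- `p` (the upper left path) and `p'` (the lower right path) are osculating: wherever both pass
through a point, `p` enters it from the left and leaves it upwards, while `p'` enters it from below
(unless it starts there) and leaves it to the right (unless it ends there). -/
def OsculatingPair (p p' : List Point) : Prop :=
  ∀ (m m' : ℕ) (i j : ℤ), p[m]? = some (i, j) → p'[m']? = some (i, j) →
    (m ≠ 0 ∧ p[m - 1]? = some (i, j - 1)) ∧ p[m + 1]? = some (i - 1, j) ∧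
    (m' ≠ 0 → p'[m' - 1]? = some (i + 1, j)) ∧
    (m' + 1 ≠ p'.length → p'[m' + 1]? = some (i, j + 1))

/-- The set of boundary point pairs `(α, β)`: `α ⊆ [a]`, `β ⊆ [b]`, `|α| = |β|`. -/
def boundaryPairs (a b : ℕ) : Set (Finset ℤ × Finset ℤ) :=
  {x | x.1 ⊆ Finset.Icc 1 (a : ℤ) ∧ x.2 ⊆ Finset.Icc 1 (b : ℤ) ∧ x.2.card = x.1.card}

/-- The set `OP(a,b,α,β)` of tuples of osculating paths, where the `k`-th path goes from
`(a, β_k)` to `(α_k, b)`, the elements of `α` and `β` being listed in increasing order. -/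
def OP (a b : ℕ) (α β : Finset ℤ) : Set (Fin α.card → List Point) :=
  {P | ∃ h : (α, β) ∈ boundaryPairs a b,
    (∀ k : Fin α.card,
      P k ∈ latticePaths a b (α.orderEmbOfFin rfl k) (β.orderEmbOfFin h.2.2 k)) ∧
    ∀ (k : ℕ) (hk : k + 1 < α.card), OsculatingPair (P ⟨k, by omega⟩) (P ⟨k + 1, hk⟩)}

/-- The vacancies: points of the rectangle through which no path passes. -/
noncomputable def vacancies (a b : ℕ) {r : ℕ} (P : Fin r → List Point) : Finset Point :=
  (rect a b).filter fun v => ∀ k, v ∉ P k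

/-- The osculations: points through which two different paths pass. -/
noncomputable def osculations (a b : ℕ) {r : ℕ} (P : Fin r → List Point) : Finset Point :=
  (rect a b).filter fun v => ∃ k k', k ≠ k' ∧ v ∈ P k ∧ v ∈ P k'

/-- The vacancy-osculation set `Z(P)` of a path tuple. -/
noncomputable def vacOsc (a b : ℕ) {r : ℕ} (P : Fin r → List Point) : Finset Point :=
  vacancies a b P ∪ osculations a b P

/-- `VOS(a,b,α,β,l)`: the vacancy-osculation sets with `l` elements of the path tuples in
`OP(a,b,α,β)`. -/
def VOS (a b : ℕ) (α β : Finset ℤ) (l : ℕ) : Set (Finset Point) :=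
  {S | ∃ P ∈ OP a b α β, (vacOsc a b P).card = l ∧ vacOsc a b P = S}

/-! ### Partitions

Partitions are represented by Mathlib's Young diagrams. Rows and columns are numbered from `0`
there, so `lam.rowLen i` is the part `λ_{i+1}`, `lam.colLen 0` is the length `ℓ(λ)`, and the content
of a cell is the same in both numberings. -/

/-- The partitions whose Young diagram fits into an `a` by `b` rectangle. -/
def Par (a b : ℕ) : Set YoungDiagram := {lam | lam.colLen 0 ≤ a ∧ lam.rowLen 0 ≤ b}

/-- The `(a,b)`-complement of a partition in `Par a b`: the rotation by 180 degrees of the part of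
the rectangle that the Young diagram leaves free. -/
def complement (a b : ℕ) (lam : YoungDiagram) : YoungDiagram where
  cells := (Finset.range a ×ˢ Finset.range b).filter
    fun c => (a - 1 - c.1, b - 1 - c.2) ∉ lam.cells
  isLowerSet := by
    rintro ⟨i, j⟩ ⟨i', j'⟩ hle hmem
    obtain ⟨h1, h2⟩ := Prod.mk_le_mk.mp hle
    simp only [Finset.coe_filter, Finset.mem_product, Finset.mem_range, Set.mem_ofPred_eq] at hmem ⊢
    refine ⟨⟨by omega, by omega⟩, fun h => hmem.2 ?_⟩
    exact lam.isLowerSet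
      (Prod.mk_le_mk.mpr ⟨by omega, by omega⟩ :
        (a - 1 - i, b - 1 - j) ≤ (a - 1 - i', b - 1 - j')) h

/-- The rank of a partition: the number of cells on the main diagonal. -/
def rank (lam : YoungDiagram) : ℕ := (lam.cells.filter fun c => c.1 = c.2).card

/-- The Frobenius coordinate `γ_{i+1}`, the number of cells in row `i` to the right of the main
diagonal (for `i < rank lam`). -/
def frobArm (lam : YoungDiagram) (i : ℕ) : ℤ := (lam.rowLen i : ℤ) - (i + 1)

/-- The Frobenius coordinate `δ_{i+1}`, the number of cells in column `i` below the main
diagonal (for `i < rank lam`). -/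
def frobLeg (lam : YoungDiagram) (i : ℕ) : ℤ := (lam.colLen i : ℤ) - (i + 1)

/-- The first component `α = {a - δ_1, …, a - δ_r}` of the boundary point pair of a partition, where
`(γ | δ)` is the Frobenius notation of the `(a,b)`-complement. -/
def alphaOf (a b : ℕ) (lam : YoungDiagram) : Finset ℤ :=
  (Finset.range (rank (complement a b lam))).image
    fun i => (a : ℤ) - frobLeg (complement a b lam) i

/-- The second component `β = {b - γ_1, …, b - γ_r}` of the boundary point pair of a partition. -/
def betaOf (a b : ℕ) (lam : YoungDiagram) : Finset ℤ :=
  (Finset.range (rank (complement a b lam))).image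
    fun i => (b : ℤ) - frobArm (complement a b lam) i

/-- Two partitions differ by a square. -/
def DifferBySquare (lam mu : YoungDiagram) : Prop :=
  (symmDiff lam.cells mu.cells).card = 1

/-- The diagonal difference of two partitions that differ by a square: the content of the one cell
in which their Young diagrams differ. -/
def diagDiff (lam mu : YoungDiagram) : ℤ :=
  ∑ c ∈ symmDiff lam.cells mu.cells, ((c.2 : ℤ) - c.1)

/-! ### Oscillating tableaux -/

/-- An oscillating tableau of length `l` (of any shape). -/
def IsOscillating {l : ℕ} (η : Fin (l + 1) → YoungDiagram) : Prop :=
  η 0 = ⊥ ∧ ∀ k : Fin l, DifferBySquare (η k.castSucc) (η k.succ)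

/-- The set `OT(λ,l)` of oscillating tableaux of shape `λ` and length `l`. -/
def OT (lam : YoungDiagram) (l : ℕ) : Set (Fin (l + 1) → YoungDiagram) :=
  {η | IsOscillating η ∧ η (Fin.last l) = lam}

/-- The profile `Ω(η)`; here `profile η k` is `Ω(η)_{k+1}`. -/
def profile {l : ℕ} (η : Fin (l + 1) → YoungDiagram) (k : Fin l) : ℤ :=
  diagDiff (η k.castSucc) (η k.succ)

/-- The set of ascents of `η` with respect to an order on the integers. -/
def ascents (prec : ℤ → ℤ → Prop) {l : ℕ} (η : Fin (l + 1) → YoungDiagram) : Set (Fin l) :=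
  {k | ∃ h : (k : ℕ) + 1 < l, prec (profile η k) (profile η ⟨k + 1, h⟩)}

/-- The number of oscillating tableaux of shape `λ` and length `l` with exactly `i` ascents. -/
noncomputable def ascentDistribution (lam : YoungDiagram) (l : ℕ) (prec : ℤ → ℤ → Prop)
    (i : ℕ) : ℕ :=
  {η ∈ OT lam l | (ascents prec η).ncard = i}.ncard

/-- The set `GOT(T,≺,λ,l)` of generalized oscillating tableaux. -/
def GOT (T : Set ℤ) (prec : ℤ → ℤ → Prop) (lam : YoungDiagram) (l : ℕ) :
    Set ((Fin l → ℤ) × (Fin (l + 1) → YoungDiagram)) :=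
  {x | (∀ k, x.1 k ∈ T) ∧ x.2 ∈ OT lam l ∧
    ∀ (k : Fin l) (h : (k : ℕ) + 1 < l),
      x.1 k < x.1 ⟨k + 1, h⟩ ∨ (x.1 k = x.1 ⟨k + 1, h⟩ ∧ k ∈ ascents prec x.2)}

/-! ### The two mappings -/

/-- A `q`-order: a total strict order on the integers with
`… ≺ q - 2 ≺ q - 1 ≺ q` and `… ≺ q + 2 ≺ q + 1 ≺ q`. -/
def IsQOrder (q : ℤ) (prec : ℤ → ℤ → Prop) : Prop :=
  IsStrictTotalOrder ℤ prec ∧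
    ∀ z z' : ℤ, ((z < z' ∧ z' ≤ q) ∨ (z > z' ∧ z' ≥ q)) → prec z z'

/-- The level function `L_q`. -/
def level (q i j : ℤ) : ℤ := if q ≤ 0 then max (i + q) j else max i (j - q)

/-- The function `G_q`; its value is the point with level `u` and content `z`. -/
def G (q u z : ℤ) : Point :=
  if q ≤ min 0 z then (u - z, u)
  else if z ≤ q ∧ q ≤ 0 then (u - q, u - q + z)
  else if 0 ≤ q ∧ q ≤ z then (u + q - z, u + q)
  else (u, u + z)

/-- The mapping `Φ_q`. -/
def Phi (q : ℤ) {l : ℕ} (x : (Fin l → ℤ) × (Fin (l + 1) → YoungDiagram)) : Finset Point :=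
  Finset.univ.image fun k : Fin l => G q (x.1 k) (profile x.2 k)

/-- `s` is the canonical ordering of `S` induced by the level function `L` and the order `prec`. -/
def IsInducedOrdering (L : ℤ → ℤ → ℤ) (prec : ℤ → ℤ → Prop) (S : Finset Point) {l : ℕ}
    (s : Fin l → Point) : Prop :=
  Function.Injective s ∧ Finset.univ.image s = S ∧
  (∀ k k' : Fin l, k < k' → (s k).1 < (s k').1 ∨ (s k).2 < (s k').2) ∧
  ∀ (k : Fin l) (h : (k : ℕ) + 1 < l),
    L (s k).1 (s k).2 < L (s ⟨k + 1, h⟩).1 (s ⟨k + 1, h⟩).2 ∨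
    (L (s k).1 (s k).2 = L (s ⟨k + 1, h⟩).1 (s ⟨k + 1, h⟩).2 ∧
      prec (content (s k)) (content (s ⟨k + 1, h⟩)))

/-- `η` is the oscillating tableau associated with the sequence of points `s`: its profile is the
sequence of contents of the points. -/
def IsAssociatedTableau {l : ℕ} (s : Fin l → Point) (η : Fin (l + 1) → YoungDiagram) : Prop :=
  IsOscillating η ∧ ∀ k, profile η k = content (s k)

/-- The induced ordering of `S`, where it exists. -/
noncomputable def inducedOrdering (L : ℤ → ℤ → ℤ) (prec : ℤ → ℤ → Prop) (l : ℕ)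
    (S : Finset Point) : Fin l → Point :=
  Classical.epsilon (IsInducedOrdering L prec S)

/-- The oscillating tableau associated with `s`, where it exists. -/
noncomputable def associatedTableau {l : ℕ} (s : Fin l → Point) : Fin (l + 1) → YoungDiagram :=
  Classical.epsilon (IsAssociatedTableau s)

/-- The mapping `Θ_{(L,≺)}` on sets of `l` points. -/
noncomputable def Theta (L : ℤ → ℤ → ℤ) (prec : ℤ → ℤ → Prop) (l : ℕ) (S : Finset Point) :
    (Fin l → ℤ) × (Fin (l + 1) → YoungDiagram) :=
  (fun k => L (inducedOrdering L prec l S k).1 (inducedOrdering L prec l S k).2,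
    associatedTableau (inducedOrdering L prec l S))

/-- The number of rows `a(n,q) = max(n, n - q)` (nonnegative, so `toNat` loses nothing). -/
def aDim (n : ℕ) (q : ℤ) : ℕ := (max (n : ℤ) (n - q)).toNat

/-- The number of columns `b(n,q) = max(n, n + q)` (nonnegative, so `toNat` loses nothing). -/
def bDim (n : ℕ) (q : ℤ) : ℕ := (max (n : ℤ) (n + q)).toNat

end Osculating

/-!
A tuple of osculating paths is the family of contour lines of a height function `h` on the
rectangle: `h i j` is the number of paths that separate the unit square to the lower right of
`(i, j)` from the upper left corner. The height functions that occur are exactly those that vanish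
on the upper and left sides and increase by `0` or `1` in both directions (`IsHeight`,
`exists_isHeight_of_mem_OP`, `exists_mem_OP_of_isHeight`). Along a diagonal, `h` increases at a
point by the number of paths through it, so vacancies and osculations are the points where it
increases by `0` or `2` instead of `1` (`mem_vacOsc_iff`).

A partition is determined by the numbers `N c` of its cells of content `c`, and a finitely
supported `N` arises in this way iff all edge states `[p ≤ 0] + N (p - 1) - N p` (the Maya diagram
of the partition) are `0` or `1`. Adding or removing a square of content `z` changes `N` at `z` by
`±1`.

The link between the two is the relation `h i j = min i j - N (j - i)`, where `N` belongs to the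
partition reached after the points up to `(i, j)` have been processed: each vacancy adds a square
to the partition and each osculation removes one, on the diagonal of the point. Under this relation
the horizontal increments of `h` are edge states of the partitions, and the vertical ones are
edge states with `0` and `1` exchanged. A set of signed points, listed in any
total order that refines the componentwise order, therefore gives a height function
iff it gives an oscillating tableau (`height_increments`, `edge_partialCount_of_height`). The
heights on the lower and right sides correspond to the final partition, which is how the boundary
points come from `λ` (`mem_betaOf_iff`, `mem_alphaOf_iff`). Comparing points by level and
then by content with respect to a `q`-order is such a total order (`before_of_le_of_ne`). That the
points of a generalized oscillating tableau have positive coordinates holds because a diagonal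
`z ≠ 0` can be used only after its neighbour closer to the main diagonal (`one_le_of_profile`).

For the ascents: the number of sequences `t` in `[n]` compatible with a tableau `η` depends only on
`n` plus the number of ascents of `η` (`ncard_weakSeqs`), and as `n` varies the resulting linear
system for the ascent distribution is triangular (`card_filter_eq_of_sum_eq`). Its right-hand sides
count vacancy-osculation sets, so they do not depend on the `q`-order.
-/

namespace Osculating

/-! ### Diagonal counts of Young diagrams -/

/-- The number of cells of content `c` of a Young diagram. -/
def diagCount (μ : YoungDiagram) (c : ℤ) : ℤ :=
  (μ.cells.filter fun x => (x.2 : ℤ) - x.1 = c).card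

/-- The edge state at position `p` of a function `N` counting cells on diagonals. If `N` counts the
cells of a Young diagram, this is the Maya diagram: it is `1` or `0` according as the
corresponding unit step of the boundary is vertical or horizontal. -/
def edge (N : ℤ → ℤ) (p : ℤ) : ℤ := (if p ≤ 0 then 1 else 0) + N (p - 1) - N p

theorem diagCount_nonneg (μ : YoungDiagram) (c : ℤ) : 0 ≤ diagCount μ c := by
  unfold diagCount; positivity

/-- The cells of a given content form an initial segment of their diagonal. -/
theorem mem_iff_lt_diagCount (μ : YoungDiagram) (i j : ℕ) :
    (i, j) ∈ μ ↔ (min i j : ℤ) < diagCount μ ((j : ℤ) - i) := by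
  set D := μ.cells.filter fun x => (x.2 : ℤ) - x.1 = (j : ℤ) - i with hD
  have hmem : ∀ x : ℕ × ℕ, x ∈ D ↔ x ∈ μ ∧ (x.2 : ℤ) - x.1 = (j : ℤ) - i := by
    intro x; simp [hD]
  have hinj : Set.InjOn (fun x : ℕ × ℕ => min x.1 x.2) D := by
    rintro ⟨x1, x2⟩ hx ⟨y1, y2⟩ hy h
    have h1 := ((hmem _).1 hx).2
    have h2 := ((hmem _).1 hy).2
    simp only at h h1 h2
    ext <;> simp only <;> omega
  have hcard : (D.image fun x : ℕ × ℕ => min x.1 x.2).card = D.card :=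
    Finset.card_image_of_injOn hinj
  have hdc : diagCount μ ((j : ℤ) - i) = (D.card : ℤ) := rfl
  constructor
  · intro h
    have hsub : Finset.range (min i j + 1) ⊆ D.image fun x : ℕ × ℕ => min x.1 x.2 := by
      intro m hm
      rw [Finset.mem_range] at hm
      refine Finset.mem_image.2 ⟨(m + (i - min i j), m + (j - min i j)), (hmem _).2 ⟨?_, ?_⟩, ?_⟩
      · exact μ.up_left_mem (by omega) (by omega) h
      · simp only; omega
      · simp only; omega
    have := Finset.card_le_card hsub
    rw [Finset.card_range, hcard] at this
    rw [hdc]; omega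
  · intro h
    by_contra hn
    have hsub : D.image (fun x : ℕ × ℕ => min x.1 x.2) ⊆ Finset.range (min i j) := by
      intro m hm
      obtain ⟨⟨x1, x2⟩, hx, rfl⟩ := Finset.mem_image.1 hm
      obtain ⟨hx1, hx2⟩ := (hmem _).1 hx
      simp only at hx2 ⊢
      rw [Finset.mem_range]
      by_contra hc
      exact hn (μ.up_left_mem (by omega) (by omega) hx1)
    have := Finset.card_le_card hsub
    rw [Finset.card_range, hcard] at this
    rw [hdc] at h; omega

theorem diagCount_injective : Function.Injective diagCount := by
  intro μ ν h
  ext ⟨i, j⟩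
  rw [YoungDiagram.mem_cells, YoungDiagram.mem_cells, mem_iff_lt_diagCount, mem_iff_lt_diagCount, h]

theorem diagCount_bot (c : ℤ) : diagCount ⊥ c = 0 := by
  simp [diagCount]

/-- A diagonal representative: the cell of content `c` and smaller coordinate `m`. -/
def diagCell (c : ℤ) (m : ℕ) : ℕ × ℕ := (m + (-c).toNat, m + c.toNat)

theorem diagCell_content (c : ℤ) (m : ℕ) :
    ((diagCell c m).2 : ℤ) - (diagCell c m).1 = c := by
  simp only [diagCell]; omega

theorem diagCell_mem_iff (μ : YoungDiagram) (c : ℤ) (m : ℕ) :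
    diagCell c m ∈ μ ↔ (m : ℤ) < diagCount μ c := by
  have h := mem_iff_lt_diagCount μ (diagCell c m).1 (diagCell c m).2
  rw [diagCell_content, Prod.mk.eta] at h
  rw [h]
  simp only [diagCell]
  push_cast
  omega

/-- The edge states of a partition are `0` or `1`: seen from the main diagonal outwards, the number
of cells of a diagonal drops by at most one at a time. -/
theorem edge_diagCount (μ : YoungDiagram) (p : ℤ) :
    edge (diagCount μ) p = 0 ∨ edge (diagCount μ) p = 1 := by
  have h0 := diagCount_nonneg μ p
  have h1 := diagCount_nonneg μ (p - 1)
  obtain ⟨x, hx⟩ := Int.eq_ofNat_of_zero_le h0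
  obtain ⟨y, hy⟩ := Int.eq_ofNat_of_zero_le h1
  have key : ∀ m m' : ℕ, (diagCell p m).1 ≤ (diagCell (p - 1) m').1 →
      (diagCell p m).2 ≤ (diagCell (p - 1) m').2 → m' < y → m < x := by
    intro m m' e1 e2 hm
    have := μ.up_left_mem e1 e2 (show diagCell (p - 1) m' ∈ μ by
      rw [diagCell_mem_iff, hy]; exact_mod_cast hm)
    have := (diagCell_mem_iff μ p m).1 this
    rw [hx] at this; exact_mod_cast this
  have key' : ∀ m m' : ℕ, (diagCell (p - 1) m').1 ≤ (diagCell p m).1 →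
      (diagCell (p - 1) m').2 ≤ (diagCell p m).2 → m < x → m' < y := by
    intro m m' e1 e2 hm
    have := μ.up_left_mem e1 e2 (show diagCell p m ∈ μ by
      rw [diagCell_mem_iff, hx]; exact_mod_cast hm)
    have := (diagCell_mem_iff μ (p - 1) m').1 this
    rw [hy] at this; exact_mod_cast this
  simp only [diagCell] at key key'
  unfold edge
  rw [hx, hy]
  by_cases hp : p ≤ 0
  · rw [if_pos hp]
    have k1 : y ≤ x := by
      by_contra hc
      exact absurd (key (y - 1) (y - 1) (by omega) (by omega) (by omega)) (by omega)
    have k2 : x ≤ y + 1 := by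
      by_contra hc
      have := key' (x - 1) (x - 2) (by omega) (by omega) (by omega)
      omega
    omega
  · rw [if_neg hp]
    have k1 : x ≤ y := by
      by_contra hc
      exact absurd (key' (x - 1) (x - 1) (by omega) (by omega) (by omega)) (by omega)
    have k2 : y ≤ x + 1 := by
      by_contra hc
      have := key (y - 2) (y - 1) (by omega) (by omega) (by omega)
      omega
    omega

/-- A finitely supported function whose edge states are all `0` or `1` counts the cells on the
diagonals of a Young diagram. -/
theorem exists_diagCount_eq (N : ℤ → ℤ) (B : ℕ) (hB : ∀ c, (B : ℤ) ≤ |c| → N c = 0)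
    (hN : ∀ p, edge N p = 0 ∨ edge N p = 1) : ∃ μ : YoungDiagram, diagCount μ = N := by
  -- going away from the main diagonal, `N` is weakly decreasing, in steps of at most `1`
  have hpos : ∀ c, 0 < c → N c ≤ N (c - 1) ∧ N (c - 1) ≤ N c + 1 := by
    intro c hc
    have := hN c
    unfold edge at this
    rw [if_neg (by omega)] at this
    omega
  have hneg : ∀ c, c ≤ 0 → N (c - 1) ≤ N c ∧ N c ≤ N (c - 1) + 1 := by
    intro c hc
    have := hN c
    unfold edge at this
    rw [if_pos hc] at this
    omega
  have bpos : ∀ k : ℕ, ∀ c : ℤ, 0 ≤ c → (B : ℤ) - k = c → 0 ≤ N c ∧ N c ≤ k := by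
    intro k
    induction k with
    | zero => intro c hc h; rw [hB c (by rw [abs_of_nonneg hc]; omega)]; simp
    | succ k ih =>
      intro c hc h
      have h1 := ih (c + 1) (by omega) (by push_cast at h; omega)
      have h2 := hpos (c + 1) (by omega)
      rw [add_sub_cancel_right] at h2
      push_cast; omega
  have bneg : ∀ k : ℕ, ∀ c : ℤ, c ≤ 0 → (B : ℤ) - k = -c → 0 ≤ N c ∧ N c ≤ k := by
    intro k
    induction k with
    | zero => intro c hc h; rw [hB c (by rw [abs_of_nonpos hc]; omega)]; simp
    | succ k ih =>
      intro c hc h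
      have h1 := ih (c - 1) (by omega) (by push_cast at h; omega)
      have h2 := hneg c (by omega)
      push_cast; omega
  have hbound : ∀ c, 0 ≤ N c ∧ N c ≤ B := by
    intro c
    by_cases hc : (B : ℤ) ≤ |c|
    · rw [hB c hc]; simp
    · rcases le_total 0 c with h | h
      · rw [abs_of_nonneg h] at hc
        have := bpos ((B : ℤ) - c).toNat c h (by omega)
        omega
      · rw [abs_of_nonpos h] at hc
        have := bneg ((B : ℤ) + c).toNat c h (by omega)
        omega
  -- the cell `(i, j)` belongs to the diagram iff `min i j < N (j - i)`
  have hleft : ∀ i j : ℕ, (min i (j + 1) : ℤ) < N ((j + 1 : ℤ) - i) →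
      (min i j : ℤ) < N ((j : ℤ) - i) := by
    intro i j h
    rw [show ((j : ℤ) - i) = ((j + 1 : ℤ) - i) - 1 by ring]
    by_cases hc : (j + 1 : ℤ) - i ≤ 0
    · have := hneg _ hc; omega
    · have := hpos _ (not_le.1 hc); omega
  have hup : ∀ i j : ℕ, (min (i + 1) j : ℤ) < N ((j : ℤ) - (i + 1)) →
      (min i j : ℤ) < N ((j : ℤ) - i) := by
    intro i j h
    rw [show ((j : ℤ) - (i + 1)) = ((j : ℤ) - i) - 1 by ring] at h
    by_cases hc : (j : ℤ) - i ≤ 0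
    · have := hneg _ hc; omega
    · have := hpos _ (not_le.1 hc); omega
  have hleft' : ∀ i j d : ℕ, (min i ((j + d : ℕ) : ℤ) : ℤ) < N (((j + d : ℕ) : ℤ) - i) →
      (min i j : ℤ) < N ((j : ℤ) - i) := by
    intro i j d
    induction d with
    | zero => simp
    | succ d ih => intro h; apply ih; apply hleft; push_cast at h ⊢; rwa [← add_assoc] at h
  have hup' : ∀ i j d : ℕ, (min ((i + d : ℕ) : ℤ) j : ℤ) < N ((j : ℤ) - (i + d : ℕ)) →
      (min i j : ℤ) < N ((j : ℤ) - i) := by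
    intro i j d
    induction d with
    | zero => simp
    | succ d ih => intro h; apply ih; apply hup; push_cast at h ⊢; rwa [← add_assoc] at h
  let μ : YoungDiagram :=
    { cells := (Finset.range (2 * B + 1) ×ˢ Finset.range (2 * B + 1)).filter
        fun x => (min x.1 x.2 : ℤ) < N ((x.2 : ℤ) - x.1)
      isLowerSet := by
        rintro ⟨i, j⟩ ⟨i', j'⟩ hle hmem
        obtain ⟨h1, h2⟩ := Prod.mk_le_mk.mp hle
        simp only [Finset.coe_filter, Finset.mem_product, Finset.mem_range,
          Set.mem_ofPred_eq] at hmem ⊢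
        refine ⟨⟨by omega, by omega⟩, ?_⟩
        obtain ⟨d, rfl⟩ := Nat.exists_eq_add_of_le h1
        obtain ⟨e, rfl⟩ := Nat.exists_eq_add_of_le h2
        exact hup' _ _ _ (hleft' _ _ _ hmem.2) }
  have hμ : ∀ i j : ℕ, (i, j) ∈ μ ↔ (min i j : ℤ) < N ((j : ℤ) - i) := by
    intro i j
    rw [← YoungDiagram.mem_cells]
    simp only [μ, Finset.mem_filter, Finset.mem_product, Finset.mem_range, and_iff_right_iff_imp]
    intro h
    have hb := hbound ((j : ℤ) - i)
    have : |(j : ℤ) - i| < B := by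
      by_contra hc
      rw [hB _ (not_lt.1 hc)] at h
      omega
    rw [abs_lt] at this
    omega
  refine ⟨μ, funext fun c => ?_⟩
  have hd : ∀ m : ℕ, (m : ℤ) < diagCount μ c ↔ (m : ℤ) < N c := by
    intro m
    rw [← diagCell_mem_iff, ← Prod.mk.eta (p := diagCell c m), hμ, diagCell_content]
    simp only [diagCell]
    push_cast
    omega
  have h0 := diagCount_nonneg μ c
  have h1 := (hbound c).1
  have e1 := hd (diagCount μ c).toNat
  have e2 := hd (N c).toNat
  omega

/-! ### Adding and removing a square -/

theorem mem_and_eq_insert_of_symmDiff_eq_singleton {α : Type*} [DecidableEq α]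
    (A B : Finset α) (x : α) (h : symmDiff A B = {x}) :
    (x ∈ B ∧ x ∉ A ∧ B = insert x A) ∨ (x ∈ A ∧ x ∉ B ∧ A = insert x B) := by
  have hm : ∀ y, (y ∈ A ∧ y ∉ B ∨ y ∈ B ∧ y ∉ A) ↔ y = x := by
    intro y
    rw [← Finset.mem_symmDiff, h, Finset.mem_singleton]
  have hx := (hm x).2 rfl
  rcases hx with hx | hx
  · right
    refine ⟨hx.1, hx.2, ?_⟩
    ext y
    rw [Finset.mem_insert]
    have := hm y
    by_cases hy : y = x
    · subst hy; tauto
    · tauto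
  · left
    refine ⟨hx.1, hx.2, ?_⟩
    ext y
    rw [Finset.mem_insert]
    have := hm y
    by_cases hy : y = x
    · subst hy; tauto
    · tauto

theorem diagCount_of_cells_eq_insert {μ ν : YoungDiagram} {x : ℕ × ℕ} (hx : x ∉ μ.cells)
    (h : ν.cells = insert x μ.cells) (c : ℤ) :
    diagCount ν c = diagCount μ c + if c = (x.2 : ℤ) - x.1 then 1 else 0 := by
  unfold diagCount
  rw [h, Finset.filter_insert]
  by_cases hc : (x.2 : ℤ) - x.1 = c
  · rw [if_pos hc, if_pos hc.symm, Finset.card_insert_of_notMem]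
    · push_cast; rfl
    · simp only [Finset.mem_filter, hx, false_and, not_false_eq_true]
  · rw [if_neg hc, if_neg (Ne.symm hc), add_zero]

/-- Partitions that differ by a square have diagonal counts that differ by `±1` on one diagonal. -/
theorem DifferBySquare.exists_sign {μ ν : YoungDiagram} (h : DifferBySquare μ ν) :
    ∃ ε : ℤ, (ε = 1 ∨ ε = -1) ∧
      ∀ c, diagCount ν c = diagCount μ c + if c = diagDiff μ ν then ε else 0 := by
  obtain ⟨x, hx⟩ := Finset.card_eq_one.1 h
  have hd : diagDiff μ ν = (x.2 : ℤ) - x.1 := by unfold diagDiff; rw [hx, Finset.sum_singleton]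
  rw [hd]
  rcases mem_and_eq_insert_of_symmDiff_eq_singleton _ _ _ hx with ⟨_, h2, h3⟩ | ⟨_, h2, h3⟩
  · exact ⟨1, Or.inl rfl, diagCount_of_cells_eq_insert h2 h3⟩
  · refine ⟨-1, Or.inr rfl, fun c => ?_⟩
    rw [diagCount_of_cells_eq_insert h2 h3 c]
    split_ifs <;> ring

theorem symmDiff_cells_of_diagCount_succ {μ ν : YoungDiagram} {z : ℤ}
    (h : ∀ c, diagCount ν c = diagCount μ c + if c = z then 1 else 0) :
    symmDiff μ.cells ν.cells = {diagCell z (diagCount μ z).toNat} := by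
  have h0 := diagCount_nonneg μ z
  ext ⟨i, j⟩
  rw [Finset.mem_symmDiff, Finset.mem_singleton]
  simp only [YoungDiagram.mem_cells, mem_iff_lt_diagCount, h, diagCell, Prod.mk.injEq]
  by_cases hc : (j : ℤ) - i = z
  · rw [if_pos hc, hc]
    omega
  · rw [if_neg hc]
    omega

theorem differBySquare_of_diagCount {μ ν : YoungDiagram} {z ε : ℤ} (hε : ε = 1 ∨ ε = -1)
    (h : ∀ c, diagCount ν c = diagCount μ c + if c = z then ε else 0) :
    DifferBySquare μ ν ∧ diagDiff μ ν = z := by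
  rcases hε with rfl | rfl
  · have := symmDiff_cells_of_diagCount_succ h
    unfold DifferBySquare diagDiff
    rw [this, Finset.sum_singleton, Finset.card_singleton]
    exact ⟨rfl, diagCell_content _ _⟩
  · have := symmDiff_cells_of_diagCount_succ (μ := ν) (ν := μ) (z := z)
      (fun c => by rw [h c]; split_ifs <;> ring)
    unfold DifferBySquare diagDiff
    rw [symmDiff_comm, this, Finset.sum_singleton, Finset.card_singleton]
    exact ⟨rfl, diagCell_content _ _⟩

/-- No diagonal carries both an addable and a removable square, so a partition and the content of
the square in which it changes determine the changed partition. -/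
theorem DifferBySquare.eq_of_diagDiff_eq {μ ν ν' : YoungDiagram} (h : DifferBySquare μ ν)
    (h' : DifferBySquare μ ν') (he : diagDiff μ ν = diagDiff μ ν') : ν = ν' := by
  obtain ⟨ε, hε, hν⟩ := h.exists_sign
  obtain ⟨ε', hε', hν'⟩ := h'.exists_sign
  rw [← he] at hν'
  set z := diagDiff μ ν
  have e1 := edge_diagCount ν z
  have e1' := edge_diagCount ν' z
  unfold edge at e1 e1'
  rw [hν, hν, if_pos rfl, if_neg (show z - 1 ≠ z by omega)] at e1
  rw [hν', hν', if_pos rfl, if_neg (show z - 1 ≠ z by omega)] at e1'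
  have : ε = ε' := by omega
  subst this
  exact diagCount_injective (funext fun c => by rw [hν, hν'])

/-! ### Oscillating tableaux as signed content sequences -/

/-- The signed number of indices `i < k` with `ω i = c`. For the profile `ω` of an oscillating
tableau and the signs `ε` of its steps, this is the number of cells of content `c` of the `k`-th
partition. -/
def partialCount {l : ℕ} (ω ε : Fin l → ℤ) (k : ℕ) (c : ℤ) : ℤ :=
  ∑ i : Fin l, if (i : ℕ) < k ∧ ω i = c then ε i else 0

theorem partialCount_zero {l : ℕ} (ω ε : Fin l → ℤ) (c : ℤ) : partialCount ω ε 0 c = 0 := by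
  simp [partialCount]

theorem partialCount_succ {l : ℕ} (ω ε : Fin l → ℤ) (k : Fin l) (c : ℤ) :
    partialCount ω ε (k + 1) c = partialCount ω ε k c + if c = ω k then ε k else 0 := by
  unfold partialCount
  have : (if c = ω k then ε k else 0) =
      ∑ i : Fin l, if i = k then (if c = ω k then ε k else 0) else 0 := by
    simp
  rw [this, ← Finset.sum_add_distrib]
  refine Finset.sum_congr rfl fun i _ => ?_
  by_cases hi : i = k
  · subst hi
    simp [eq_comm]
  · have : (i : ℕ) ≠ k := fun h => hi (Fin.ext h)
    have e : (i : ℕ) < (k : ℕ) + 1 ↔ (i : ℕ) < k := by omega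
    simp [hi, e]

theorem partialCount_eq_zero {l : ℕ} (ω ε : Fin l → ℤ) (k : ℕ) (c : ℤ)
    (h : ∀ i : Fin l, (i : ℕ) < k → ω i ≠ c) : partialCount ω ε k c = 0 := by
  unfold partialCount
  refine Finset.sum_eq_zero fun i _ => if_neg ?_
  rintro ⟨h1, h2⟩
  exact h i h1 h2

theorem partialCount_last {l : ℕ} (ω ε : Fin l → ℤ) (c : ℤ) :
    partialCount ω ε l c = ∑ i : Fin l, if ω i = c then ε i else 0 := by
  unfold partialCount
  refine Finset.sum_congr rfl fun i _ => ?_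
  simp [i.isLt]

theorem IsOscillating.exists_signs {l : ℕ} {η : Fin (l + 1) → YoungDiagram}
    (h : IsOscillating η) : ∃ ε : Fin l → ℤ, (∀ i, ε i = 1 ∨ ε i = -1) ∧
      ∀ k : Fin (l + 1), diagCount (η k) = partialCount (profile η) ε k := by
  choose ε hε hN using fun k => (h.2 k).exists_sign
  refine ⟨ε, hε, fun k => ?_⟩
  induction k using Fin.induction with
  | zero =>
    rw [h.1]
    funext c
    rw [diagCount_bot]
    exact (partialCount_zero _ _ c).symm
  | succ k ih =>
    funext c
    rw [hN k c, ih, Fin.val_succ, partialCount_succ]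
    rfl

theorem IsOscillating.ext {l : ℕ} {η η' : Fin (l + 1) → YoungDiagram}
    (h : IsOscillating η) (h' : IsOscillating η') (he : profile η = profile η') : η = η' := by
  funext k
  induction k using Fin.induction with
  | zero => rw [h.1, h'.1]
  | succ k ih =>
    have h1 := h.2 k
    have h2 := h'.2 k
    have e := congrFun he k
    unfold profile at e
    rw [← ih] at h2 e
    exact h1.eq_of_diagDiff_eq h2 e

/-- A signed content sequence whose partial counts all have edge states `0` or `1` comes from an
oscillating tableau. -/
theorem exists_isOscillating {l : ℕ} (ω ε : Fin l → ℤ) (hε : ∀ i, ε i = 1 ∨ ε i = -1)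
    (hedge : ∀ k ≤ l, ∀ p, edge (partialCount ω ε k) p = 0 ∨ edge (partialCount ω ε k) p = 1) :
    ∃ η : Fin (l + 1) → YoungDiagram, IsOscillating η ∧ profile η = ω ∧
      ∀ k : Fin (l + 1), diagCount (η k) = partialCount ω ε k := by
  have hex : ∀ k : Fin (l + 1), ∃ μ : YoungDiagram, diagCount μ = partialCount ω ε k := by
    intro k
    refine exists_diagCount_eq _ ((∑ i, (ω i).natAbs) + 1) (fun c hc => ?_)
      (hedge k (Nat.lt_succ_iff.1 k.isLt))
    refine partialCount_eq_zero _ _ _ _ fun i _ hi => ?_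
    have : (ω i).natAbs ≤ ∑ i, (ω i).natAbs :=
      Finset.single_le_sum (f := fun i => (ω i).natAbs) (fun _ _ => Nat.zero_le _)
        (Finset.mem_univ i)
    rw [hi] at this
    rw [Int.abs_eq_natAbs] at hc
    omega
  choose η hη using hex
  have hstep : ∀ k : Fin l, DifferBySquare (η k.castSucc) (η k.succ) ∧
      diagDiff (η k.castSucc) (η k.succ) = ω k := by
    intro k
    refine differBySquare_of_diagCount (hε k) fun c => ?_
    rw [hη, hη, Fin.val_succ, partialCount_succ]
    rfl
  refine ⟨η, ⟨diagCount_injective (funext fun c => ?_), fun k => (hstep k).1⟩,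
    funext fun k => (hstep k).2, hη⟩
  rw [hη, diagCount_bot]
  exact partialCount_zero _ _ c

/-- A square of nonzero content can change only after the diagonal next to it, on the side of the
main diagonal, has been occupied. -/
theorem IsOscillating.exists_lt_profile {l : ℕ} {η : Fin (l + 1) → YoungDiagram}
    (h : IsOscillating η) (k : Fin l) (hk : profile η k ≠ 0) :
    ∃ i : Fin l, i < k ∧ profile η i = profile η k - (profile η k).sign := by
  by_contra! hc
  obtain ⟨ε, hε, hN⟩ := h.exists_signs
  set z := profile η k with hz
  have h0 : ∀ m : ℕ, m ≤ k → partialCount (profile η) ε m (z - z.sign) = 0 := by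
    intro m hm
    refine partialCount_eq_zero _ _ _ _ fun i hi => hc i ?_
    exact Fin.lt_def.2 (by omega)
  have n1 := hN k.castSucc
  have n2 := hN k.succ
  have a1 := congrFun n1 (z - z.sign)
  have a2 := congrFun n2 (z - z.sign)
  have b1 := congrFun n1 z
  have b2 := congrFun n2 z
  rw [Fin.val_succ, partialCount_succ, ← hz] at a2 b2
  rw [if_pos rfl] at b2
  rw [Fin.val_castSucc] at a1 b1
  rw [h0 k le_rfl] at a1 a2
  have p1 := diagCount_nonneg (η k.castSucc) z
  have p2 := diagCount_nonneg (η k.succ) z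
  have hεk := hε k
  rcases lt_or_gt_of_ne hk with hneg | hpos
  · rw [Int.sign_eq_neg_one_of_neg hneg] at a1 a2
    rw [if_neg (by omega)] at a2
    have e1 := edge_diagCount (η k.castSucc) (z - -1)
    have e2 := edge_diagCount (η k.succ) (z - -1)
    unfold edge at e1 e2
    rw [if_pos (by omega), show z - -1 - 1 = z by ring] at e1 e2
    omega
  · rw [Int.sign_eq_one_of_pos hpos] at a1 a2
    rw [if_neg (by omega)] at a2
    have e1 := edge_diagCount (η k.castSucc) z
    have e2 := edge_diagCount (η k.succ) z
    unfold edge at e1 e2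
    rw [if_neg (by omega)] at e1 e2
    omega

/-! ### The total order on lattice points -/

/-- The strict total order on lattice points by level, points of the same level being compared by
content. -/
def Before (q : ℤ) (prec : ℤ → ℤ → Prop) (v w : Point) : Prop :=
  level q v.1 v.2 < level q w.1 w.2 ∨
    (level q v.1 v.2 = level q w.1 w.2 ∧ prec (content v) (content w))

theorem level_G (q u z : ℤ) : level q (G q u z).1 (G q u z).2 = u := by
  unfold level G
  split_ifs <;> simp only <;> omega

theorem content_G (q u z : ℤ) : content (G q u z) = z := by
  unfold content G
  split_ifs <;> simp only <;> omega

theorem eq_of_level_eq_of_content_eq {q : ℤ} {v w : Point}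
    (h : level q v.1 v.2 = level q w.1 w.2) (h' : content v = content w) : v = w := by
  unfold level at h
  unfold content at h'
  ext
  · split_ifs at h <;> omega
  · split_ifs at h <;> omega

theorem G_level_content (q : ℤ) (v : Point) : G q (level q v.1 v.2) (content v) = v :=
  eq_of_level_eq_of_content_eq (level_G _ _ _) (content_G _ _ _)

theorem before_isStrictTotalOrder {q : ℤ} {prec : ℤ → ℤ → Prop} (h : IsQOrder q prec) :
    IsStrictTotalOrder Point (Before q prec) := by
  have := h.1
  refine { trichotomous := ?_, irrefl := ?_, trans := ?_ }
  · intro v w h1 h2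
    unfold Before at h1 h2
    push Not at h1 h2
    have e : level q v.1 v.2 = level q w.1 w.2 := le_antisymm h2.1 h1.1
    refine eq_of_level_eq_of_content_eq e ?_
    rcases trichotomous_of prec (content v) (content w) with h3 | h3 | h3
    · exact absurd h3 (h1.2 e)
    · exact h3
    · exact absurd h3 (h2.2 e.symm)
  · rintro v (h1 | h1)
    · exact lt_irrefl _ h1
    · exact irrefl_of prec _ h1.2
  · rintro u v w (h1 | h1) (h2 | h2)
    · exact Or.inl (h1.trans h2)
    · exact Or.inl (h2.1 ▸ h1)
    · exact Or.inl (h1.1 ▸ h2)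
    · exact Or.inr ⟨h1.1.trans h2.1, trans_of prec h1.2 h2.2⟩

/-- The total order refines the componentwise order: along a level, which has the shape of a hook
with its corner at content `q`, a `q`-order increases on both arms towards the corner. -/
theorem before_of_le_of_ne {q : ℤ} {prec : ℤ → ℤ → Prop} (h : IsQOrder q prec) {v w : Point}
    (h1 : v.1 ≤ w.1) (h2 : v.2 ≤ w.2) (hne : v ≠ w) : Before q prec v w := by
  have hne' : v.1 ≠ w.1 ∨ v.2 ≠ w.2 := by
    by_contra! hc
    exact hne (Prod.ext hc.1 hc.2)
  unfold Before
  by_cases hl : level q v.1 v.2 < level q w.1 w.2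
  · exact Or.inl hl
  · refine Or.inr ?_
    unfold level at hl ⊢
    refine ⟨by split_ifs at hl ⊢ <;> omega, h.2 _ _ ?_⟩
    unfold content
    split_ifs at hl <;> omega

theorem before_asymm {q : ℤ} {prec : ℤ → ℤ → Prop} (h : IsQOrder q prec) {v w : Point}
    (h1 : Before q prec v w) : ¬ Before q prec w v := by
  have := before_isStrictTotalOrder h
  exact asymm_of (Before q prec) h1

/-- For points on equal or adjacent diagonals the componentwise order is total, so it agrees with
the order by level and content. -/
theorem not_before_iff_of_content {q : ℤ} {prec : ℤ → ℤ → Prop} (h : IsQOrder q prec) {v w : Point}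
    (hc : content v ≤ content w + 1) (hc' : content w ≤ content v + 1) :
    ¬ Before q prec w v ↔ v.1 ≤ w.1 ∧ v.2 ≤ w.2 := by
  unfold content at hc hc'
  constructor
  · intro hb
    by_contra hn
    refine hb (before_of_le_of_ne h ?_ ?_ ?_)
    · omega
    · omega
    · rintro rfl; exact hn ⟨le_rfl, le_rfl⟩
  · rintro ⟨h1, h2⟩ hb
    by_cases he : v = w
    · subst he; exact before_asymm h hb hb
    · exact before_asymm h hb (before_of_le_of_ne h h1 h2 he)

theorem fin_lt_of_succ {α : Type*} {r : α → α → Prop} (ht : ∀ a b c, r a b → r b c → r a c) {l : ℕ}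
    {s : Fin l → α} (hs : ∀ (k : Fin l) (h : (k : ℕ) + 1 < l), r (s k) (s ⟨k + 1, h⟩))
    {k k' : Fin l} (h : k < k') : r (s k) (s k') := by
  obtain ⟨k, hk⟩ := k
  obtain ⟨k', hk'⟩ := k'
  have h' : k < k' := h
  obtain ⟨d, rfl⟩ := Nat.exists_eq_add_of_lt h'
  induction d with
  | zero => exact hs ⟨k, hk⟩ hk'
  | succ d ih =>
    exact ht _ _ _ (ih (by omega) (Fin.lt_def.2 (by simp only; omega)) (by omega))
      (hs ⟨k + d + 1, by omega⟩ hk')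

theorem existsUnique_sorted {α : Type*} [DecidableEq α] (r : α → α → Prop)
    [IsStrictTotalOrder α r] (S : Finset α) {l : ℕ} (hS : S.card = l) :
    ∃! s : Fin l → α, (∀ k k', k < k' → r (s k) (s k')) ∧ Finset.univ.image s = S := by
  classical
  let _ := linearOrderOfSTO r
  refine ⟨S.orderEmbOfFin hS, ⟨fun k k' h => (S.orderEmbOfFin hS).strictMono h, ?_⟩, ?_⟩
  · have := Finset.image_orderEmbOfFin_univ S hS
    convert this
  · rintro s ⟨h1, h2⟩
    refine Finset.orderEmbOfFin_unique hS (fun k => ?_) h1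
    rw [← h2]
    exact Finset.mem_image_of_mem _ (Finset.mem_univ k)

theorem isInducedOrdering_iff {q : ℤ} {prec : ℤ → ℤ → Prop} (h : IsQOrder q prec) (S : Finset Point)
    {l : ℕ} (s : Fin l → Point) : IsInducedOrdering (level q) prec S s ↔
      (∀ k k', k < k' → Before q prec (s k) (s k')) ∧ Finset.univ.image s = S := by
  have := before_isStrictTotalOrder h
  constructor
  · rintro ⟨_, h2, _, h4⟩
    exact ⟨fun k k' => fin_lt_of_succ (r := Before q prec) (s := s)
      (fun _ _ _ => trans_of (Before q prec)) h4, h2⟩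
  · rintro ⟨h1, h2⟩
    refine ⟨?_, h2, fun k k' hk => ?_, fun k hk => h1 _ _ (Fin.lt_def.2 (Nat.lt_succ_self _))⟩
    · intro k k' hk
      rcases lt_trichotomy k k' with hlt | he | hlt
      · exact absurd (hk ▸ h1 _ _ hlt) (irrefl_of _ _)
      · exact he
      · exact absurd (hk ▸ h1 _ _ hlt) (irrefl_of _ _)
    · by_contra! hc
      by_cases he : s k' = s k
      · exact irrefl_of (Before q prec) _ (he ▸ h1 _ _ hk)
      · exact before_asymm h (h1 _ _ hk) (before_of_le_of_ne h hc.1 hc.2 he)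

/-! ### The height function of a signed sequence of points -/

/-- The height function of a sequence of points `s` with signs `ε`. Along each diagonal it increases
by `1`, by `0` at a point of sign `1` (a vacancy) and by `2` at a point of sign `-1`
(an osculation). Its value at `v` refers to the unit square to the lower right of `v`, and counts
the paths that separate this square from the upper left corner. -/
def height {l : ℕ} (s : Fin l → Point) (ε : Fin l → ℤ) (v : Point) : ℤ :=
  min v.1 v.2 - ∑ i, if content (s i) = content v ∧ (s i).1 ≤ v.1 then ε i else 0

theorem exists_forall_lt_iff {l : ℕ} (Q : Fin l → Prop) (hQ : ∀ i j, i < j → Q j → Q i) :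
    ∃ k ≤ l, ∀ i : Fin l, (i : ℕ) < k ↔ Q i := by
  classical
  have hex : ∃ k, ∀ h : k < l, ¬ Q ⟨k, h⟩ := ⟨l, fun h => absurd h (lt_irrefl _)⟩
  refine ⟨Nat.find hex, Nat.find_min' hex fun h => absurd h (lt_irrefl _), fun i => ⟨fun h => ?_,
    fun h => ?_⟩⟩
  · have := Nat.find_min hex h
    push Not at this
    exact this.2
  · by_contra hc
    have hspec := Nat.find_spec hex
    rcases (not_lt.1 hc).eq_or_lt with he | hlt
    · refine hspec (he ▸ i.isLt) ?_
      convert h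
    · exact hspec (hlt.trans i.isLt) (hQ ⟨_, hlt.trans i.isLt⟩ i (Fin.lt_def.2 hlt) h)

section Height

variable {q : ℤ} {prec : ℤ → ℤ → Prop} {l : ℕ} {s : Fin l → Point} {ε : Fin l → ℤ}

/-- At the moment when exactly the points up to `w` have been processed, the partial counts on the
diagonals next to `w` are given by the heights around `w`. -/
theorem partialCount_eq_sub_height (hq : IsQOrder q prec) {w v : Point} {k : ℕ}
    (hk : ∀ i : Fin l, (i : ℕ) < k ↔ ¬ Before q prec w (s i))
    (hv : v = w ∨ v = (w.1, w.2 - 1) ∨ v = (w.1 - 1, w.2)) :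
    partialCount (fun i => content (s i)) ε k (content v) = min v.1 v.2 - height s ε v := by
  unfold partialCount height
  rw [sub_sub_cancel]
  refine Finset.sum_congr rfl fun i _ => ?_
  by_cases hc : content (s i) = content v
  · have h1 : content (s i) ≤ content w + 1 ∧ content w ≤ content (s i) + 1 := by
      rw [hc]; rcases hv with rfl | rfl | rfl <;> simp only [content] <;> omega
    have h2 := not_before_iff_of_content hq h1.1 h1.2
    rw [← hk] at h2
    have h3 : (i : ℕ) < k ↔ (s i).1 ≤ v.1 := by
      rw [h2]
      unfold content at hc
      rcases hv with rfl | rfl | rfl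
      · omega
      · simp only at hc ⊢; omega
      · simp only at hc ⊢; omega
    simp [hc, h3]
  · simp [hc]

theorem height_sub_left (hq : IsQOrder q prec) {w : Point} {k : ℕ}
    (hk : ∀ i : Fin l, (i : ℕ) < k ↔ ¬ Before q prec w (s i)) :
    height s ε w - height s ε (w.1, w.2 - 1) =
      edge (partialCount (fun i => content (s i)) ε k) (content w) := by
  have e1 := partialCount_eq_sub_height (ε := ε) hq hk (Or.inl rfl)
  have e2 := partialCount_eq_sub_height (ε := ε) hq hk (Or.inr (Or.inl rfl))
  rw [show content (w.1, w.2 - 1) = content w - 1 by unfold content; ring] at e2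
  unfold edge
  rw [e1, e2]
  unfold content
  simp only
  split_ifs <;> omega

theorem height_sub_up (hq : IsQOrder q prec) {w : Point} {k : ℕ}
    (hk : ∀ i : Fin l, (i : ℕ) < k ↔ ¬ Before q prec w (s i)) :
    height s ε w - height s ε (w.1 - 1, w.2) =
      1 - edge (partialCount (fun i => content (s i)) ε k) (content w + 1) := by
  have e1 := partialCount_eq_sub_height (ε := ε) hq hk (Or.inl rfl)
  have e2 := partialCount_eq_sub_height (ε := ε) hq hk (Or.inr (Or.inr rfl))
  rw [show content (w.1 - 1, w.2) = content w + 1 by unfold content; ring] at e2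
  unfold edge
  rw [add_sub_cancel_right, e1, e2]
  unfold content
  simp only
  split_ifs <;> omega

/-- If all partial counts are those of partitions, then the height function has increments
`0` and `1`. -/
theorem height_increments (hq : IsQOrder q prec) (hs : ∀ k k', k < k' → Before q prec (s k) (s k'))
    (hedge : ∀ k ≤ l, ∀ p, edge (partialCount (fun i => content (s i)) ε k) p = 0 ∨
      edge (partialCount (fun i => content (s i)) ε k) p = 1) (w : Point) :
    (height s ε w - height s ε (w.1, w.2 - 1) = 0 ∨
      height s ε w - height s ε (w.1, w.2 - 1) = 1) ∧
    (height s ε w - height s ε (w.1 - 1, w.2) = 0 ∨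
      height s ε w - height s ε (w.1 - 1, w.2) = 1) := by
  have := before_isStrictTotalOrder hq
  obtain ⟨k, hkl, hk⟩ := exists_forall_lt_iff (fun i => ¬ Before q prec w (s i))
    (fun i j hij hj hi => hj (trans_of (Before q prec) hi (hs i j hij)))
  rw [height_sub_left hq hk, height_sub_up hq hk]
  have h1 := hedge k hkl (content w)
  have h2 := hedge k hkl (content w + 1)
  omega

theorem edge_partialCount_succ_of_ne (ω ε : Fin l → ℤ) (k : Fin l) {p : ℤ} (h1 : p ≠ ω k)
    (h2 : p ≠ ω k + 1) : edge (partialCount ω ε (k + 1)) p = edge (partialCount ω ε k) p := by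
  unfold edge
  rw [partialCount_succ, partialCount_succ, if_neg h1, if_neg (show p - 1 ≠ ω k by omega),
    add_zero, add_zero]

/-- Conversely, increments `0` and `1` of the height function at the points of the sequence make all
partial counts those of partitions: each point changes only the two edge states next to it. -/
theorem edge_partialCount_of_height (hq : IsQOrder q prec)
    (hs : ∀ k k', k < k' → Before q prec (s k) (s k'))
    (hheight : ∀ i, (height s ε (s i) - height s ε ((s i).1, (s i).2 - 1) = 0 ∨
      height s ε (s i) - height s ε ((s i).1, (s i).2 - 1) = 1) ∧
    (height s ε (s i) - height s ε ((s i).1 - 1, (s i).2) = 0 ∨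
      height s ε (s i) - height s ε ((s i).1 - 1, (s i).2) = 1)) (k : ℕ) (hkl : k ≤ l) (p : ℤ) :
    edge (partialCount (fun i => content (s i)) ε k) p = 0 ∨
      edge (partialCount (fun i => content (s i)) ε k) p = 1 := by
  induction k with
  | zero =>
    unfold edge
    rw [partialCount_zero, partialCount_zero]
    split_ifs <;> simp
  | succ k ih =>
    have hcut : ∀ i : Fin l, (i : ℕ) < k + 1 ↔ ¬ Before q prec (s ⟨k, hkl⟩) (s i) := by
      have := before_isStrictTotalOrder hq
      intro i
      constructor
      · intro hi hb
        rcases (Nat.lt_succ_iff.1 hi).eq_or_lt with he | hlt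
        · subst he; exact irrefl_of (Before q prec) _ hb
        · exact before_asymm hq hb (hs i ⟨k, hkl⟩ (Fin.lt_def.2 hlt))
      · intro hb
        by_contra hc
        exact hb (hs _ _ (Fin.lt_def.2 (by simp only; omega)))
    have h := hheight ⟨k, hkl⟩
    rw [height_sub_left hq hcut, height_sub_up hq hcut] at h
    by_cases h1 : p = content (s ⟨k, hkl⟩)
    · rw [h1]; exact h.1
    by_cases h2 : p = content (s ⟨k, hkl⟩) + 1
    · rw [h2]; omega
    · rw [edge_partialCount_succ_of_ne (fun i => content (s i)) ε ⟨k, hkl⟩ h1 h2]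
      exact ih (by omega)

end Height

/-! ### Lattice paths, one point on each diagonal -/

theorem Step.content_eq {v w : Point} (h : Step v w) : content w = content v + 1 := by
  unfold Step at h
  unfold content
  simp only [Prod.ext_iff, Prod.fst_sub, Prod.snd_sub] at h
  omega

theorem Step.cases {v w : Point} (h : Step v w) :
    w = (v.1, v.2 + 1) ∨ w = (v.1 - 1, v.2) := by
  unfold Step at h
  simp only [Prod.ext_iff, Prod.fst_sub, Prod.snd_sub] at h ⊢
  omega

section Paths

variable {a b : ℕ} {x y : ℤ} {p : List Point}

theorem latticePaths.step (hp : p ∈ latticePaths a b x y) {m : ℕ} {v w : Point}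
    (hv : p[m]? = some v) (hw : p[m + 1]? = some w) : Step v w := by
  obtain ⟨_, _, h⟩ := hp
  rw [List.isChain_iff_getElem] at h
  obtain ⟨h1, rfl⟩ := List.getElem?_eq_some_iff.1 hv
  obtain ⟨h2, rfl⟩ := List.getElem?_eq_some_iff.1 hw
  exact h m h2

/-- The position of a point in a path is determined by its content. -/
theorem latticePaths.getElem?_content (hp : p ∈ latticePaths a b x y) {m : ℕ} {v : Point}
    (hv : p[m]? = some v) : content v = y - a + m ∧ v.1 ≤ a ∧ y ≤ v.2 := by
  induction m generalizing v with
  | zero =>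
    have h := hp.1
    rw [List.head?_eq_getElem?, hv, Option.some_inj] at h
    subst h
    simp [content]
  | succ m ih =>
    have hlt := (List.getElem?_eq_some_iff.1 hv).1
    have hm : p[m]? = some p[m] := List.getElem?_eq_getElem (by omega)
    have h1 := ih hm
    have h2 := latticePaths.step hp hm hv
    have h3 := h2.content_eq
    have h4 := h2.cases
    rw [h3, h1.1]
    push_cast
    refine ⟨by ring, ?_⟩
    rcases h4 with h4 | h4 <;> rw [h4] <;> simp only <;> omega

theorem latticePaths.length_eq (hp : p ∈ latticePaths a b x y) :
    (p.length : ℤ) = (b - x) - (y - a) + 1 := by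
  have h := hp.2.1
  rw [List.getLast?_eq_getElem?] at h
  have h1 := latticePaths.getElem?_content hp h
  have h2 := (List.getElem?_eq_some_iff.1 h).1
  have h3 := h1.1
  unfold content at h3
  simp only at h3
  omega

theorem latticePaths.bounds (hp : p ∈ latticePaths a b x y) {v : Point} (hv : v ∈ p) :
    x ≤ v.1 ∧ v.1 ≤ a ∧ y ≤ v.2 ∧ v.2 ≤ b := by
  have key : ∀ d m : ℕ, ∀ v, m + d + 1 = p.length → p[m]? = some v → x ≤ v.1 ∧ v.2 ≤ b := by
    intro d
    induction d with
    | zero =>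
      intro m v hm hv
      have h := hp.2.1
      rw [List.getLast?_eq_getElem?, ← hm, Nat.add_zero, Nat.add_sub_cancel, hv,
        Option.some_inj] at h
      rw [h]
      exact ⟨le_rfl, le_rfl⟩
    | succ d ih =>
      intro m v hm hv
      have hs : p[m + 1]? = some p[m + 1] := List.getElem?_eq_getElem (by omega)
      have h1 := ih (m + 1) _ (by omega) hs
      rcases (latticePaths.step hp hv hs).cases with h4 | h4 <;> rw [h4] at h1 <;>
        simp only at h1 <;> omega
  obtain ⟨m, hm⟩ := List.mem_iff_getElem?.1 hv
  have h1 := (latticePaths.getElem?_content hp hm).2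
  have h2 := key (p.length - m - 1) m v
    (by have := (List.getElem?_eq_some_iff.1 hm).1; omega) hm
  omega

theorem latticePaths.mem_iff (hp : p ∈ latticePaths a b x y) {v : Point} :
    v ∈ p ↔ p[(content v - (y - a)).toNat]? = some v ∧ y - a ≤ content v := by
  constructor
  · intro h
    obtain ⟨m, hm⟩ := List.mem_iff_getElem?.1 h
    have h1 := (latticePaths.getElem?_content hp hm).1
    have : (content v - (y - a)).toNat = m := by omega
    rw [this]
    exact ⟨hm, by omega⟩
  · intro h
    exact List.mem_iff_getElem?.2 ⟨_, h.1⟩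

theorem latticePaths.eq_of_content (hp : p ∈ latticePaths a b x y) {v w : Point} (hv : v ∈ p)
    (hw : w ∈ p) (h : content v = content w) : v = w := by
  have h1 := ((latticePaths.mem_iff hp).1 hv).1
  have h2 := ((latticePaths.mem_iff hp).1 hw).1
  rw [h, h2, Option.some_inj] at h1
  exact h1.symm

theorem latticePaths.exists_of_content (hp : p ∈ latticePaths a b x y) {c : ℤ} (h1 : y - a ≤ c)
    (h2 : c ≤ b - x) : ∃ v ∈ p, content v = c := by
  have hl := latticePaths.length_eq hp
  have hlt : (c - (y - a)).toNat < p.length := by omega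
  have hm : p[(c - (y - a)).toNat]? = some p[(c - (y - a)).toNat] := List.getElem?_eq_getElem hlt
  refine ⟨_, List.getElem_mem hlt, ?_⟩
  have := (latticePaths.getElem?_content hp hm).1
  omega

theorem latticePaths.content_bounds (hp : p ∈ latticePaths a b x y) {v : Point} (hv : v ∈ p) :
    y - a ≤ content v ∧ content v ≤ b - x := by
  have := latticePaths.bounds hp hv
  unfold content
  omega

theorem latticePaths.step_of_content (hp : p ∈ latticePaths a b x y) {v w : Point} (hv : v ∈ p)
    (hw : w ∈ p) (h : content w = content v + 1) : Step v w := by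
  have h1 := (latticePaths.mem_iff hp).1 hv
  have h2 := (latticePaths.mem_iff hp).1 hw
  refine latticePaths.step hp h1.1 ?_
  rw [← h2.1]
  congr 1
  omega

theorem latticePaths.start_mem (hp : p ∈ latticePaths a b x y) : ((a : ℤ), y) ∈ p :=
  List.mem_of_head? hp.1

theorem latticePaths.end_mem (hp : p ∈ latticePaths a b x y) : (x, (b : ℤ)) ∈ p :=
  List.mem_of_getLast? hp.2.1

/-- The osculation condition in terms of points: at a common point, the upper left path comes from
the left and leaves upwards. -/
theorem OsculatingPair.mem_of_mem {p' : List Point} (h : OsculatingPair p p') {v : Point}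
    (hv : v ∈ p) (hv' : v ∈ p') : (v.1, v.2 - 1) ∈ p ∧ (v.1 - 1, v.2) ∈ p := by
  obtain ⟨m, hm⟩ := List.mem_iff_getElem?.1 hv
  obtain ⟨m', hm'⟩ := List.mem_iff_getElem?.1 hv'
  obtain ⟨h1, h2, _⟩ := h m m' v.1 v.2 hm hm'
  exact ⟨List.mem_iff_getElem?.2 ⟨_, h1.2⟩, List.mem_iff_getElem?.2 ⟨_, h2⟩⟩

end Paths

/-! ### Height functions of path tuples -/

/-- The height functions on the rectangle with boundary data `(α, β)`: integer functions on
`[0, a] × [0, b]` that vanish for `i = 0` and `j = 0`, increase by `0` or `1` in both directions,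
and increase along the lower and the right boundary exactly at `β` and `α`. -/
structure IsHeight (a b : ℕ) (α β : Finset ℤ) (h : ℤ → ℤ → ℤ) : Prop where
  top : ∀ j : ℤ, 0 ≤ j → j ≤ b → h 0 j = 0
  left : ∀ i : ℤ, 0 ≤ i → i ≤ a → h i 0 = 0
  right_step : ∀ i j : ℤ, 0 ≤ i → i ≤ a → 1 ≤ j → j ≤ b →
    h i (j - 1) ≤ h i j ∧ h i j ≤ h i (j - 1) + 1
  down_step : ∀ i j : ℤ, 1 ≤ i → i ≤ a → 0 ≤ j → j ≤ b →
    h (i - 1) j ≤ h i j ∧ h i j ≤ h (i - 1) j + 1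
  bottom : ∀ j : ℤ, 1 ≤ j → j ≤ b → h a j - h a (j - 1) = if j ∈ β then 1 else 0
  right : ∀ i : ℤ, 1 ≤ i → i ≤ a → h i b - h (i - 1) b = if i ∈ α then 1 else 0

/-- The paths of a tuple are the contours of a height function: the `k`-th path, counted from `0`,
consists of the points at which the height passes from at most `k` to more than `k` along the
diagonal. -/
def IsContour (a b : ℕ) {r : ℕ} (P : Fin r → List Point) (h : ℤ → ℤ → ℤ) : Prop :=
  ∀ i j : ℤ, 1 ≤ i → i ≤ a → 1 ≤ j → j ≤ b → ∀ k : Fin r,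
    (i, j) ∈ P k ↔ h (i - 1) (j - 1) ≤ (k : ℕ) ∧ ((k : ℕ) : ℤ) < h i j

theorem mem_rect_iff {a b : ℕ} {v : Point} :
    v ∈ rect a b ↔ 1 ≤ v.1 ∧ v.1 ≤ a ∧ 1 ≤ v.2 ∧ v.2 ≤ b := by
  unfold rect
  rw [Finset.mem_product, Finset.mem_Icc, Finset.mem_Icc]
  tauto

/-- The height along a boundary side counts the boundary points passed. -/
theorem eq_card_filter_le {n : ℕ} {B : Finset ℤ} (hB : B ⊆ Finset.Icc 1 (n : ℤ)) {g : ℤ → ℤ}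
    (h0 : g 0 = 0) (hg : ∀ j : ℤ, 1 ≤ j → j ≤ n → g j - g (j - 1) = if j ∈ B then 1 else 0)
    (j : ℕ) (hj : j ≤ n) : g j = (B.filter (· ≤ (j : ℤ))).card := by
  induction j with
  | zero =>
    rw [Nat.cast_zero, h0, Finset.filter_false_of_mem]
    · simp
    · intro x hx
      have := (Finset.mem_Icc.1 (hB hx)).1
      omega
  | succ j ih =>
    have h1 := hg (j + 1 : ℕ) (by push_cast; omega) (by exact_mod_cast hj)
    rw [show ((j + 1 : ℕ) : ℤ) - 1 = j by push_cast; ring, ih (by omega)] at h1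
    rw [eq_add_of_sub_eq h1]
    by_cases hm : ((j + 1 : ℕ) : ℤ) ∈ B
    · rw [if_pos hm]
      have : B.filter (· ≤ ((j + 1 : ℕ) : ℤ)) =
          insert ((j + 1 : ℕ) : ℤ) (B.filter (· ≤ (j : ℤ))) := by
        ext x
        simp only [Finset.mem_filter, Finset.mem_insert]
        constructor
        · rintro ⟨hx, hle⟩
          by_cases he : x = ((j + 1 : ℕ) : ℤ)
          · exact Or.inl he
          · exact Or.inr ⟨hx, by push_cast at *; omega⟩
        · rintro (rfl | ⟨hx, hle⟩)
          · exact ⟨hm, le_rfl⟩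
          · exact ⟨hx, by push_cast; omega⟩
      rw [this, Finset.card_insert_of_notMem]
      · push_cast; ring
      · simp
    · rw [if_neg hm, zero_add]
      congr 2
      ext x
      simp only [Finset.mem_filter]
      constructor
      · rintro ⟨hx, hle⟩
        exact ⟨hx, by push_cast; omega⟩
      · rintro ⟨hx, hle⟩
        have : x ≠ ((j + 1 : ℕ) : ℤ) := by rintro rfl; exact hm hx
        exact ⟨hx, by push_cast at *; omega⟩

theorem card_filter_le_orderEmbOfFin {B : Finset ℤ} {r : ℕ} (hr : B.card = r) (k : Fin r) :
    (B.filter (· ≤ B.orderEmbOfFin hr k)).card = k + 1 := by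
  have : B.filter (· ≤ B.orderEmbOfFin hr k) =
      (Finset.Iic k).map (B.orderEmbOfFin hr).toEmbedding := by
    ext x
    simp only [Finset.mem_filter, Finset.mem_map, Finset.mem_Iic]
    constructor
    · rintro ⟨hx, hle⟩
      have : x ∈ Set.range (B.orderEmbOfFin hr) := by rw [Finset.range_orderEmbOfFin]; exact hx
      obtain ⟨i, rfl⟩ := this
      exact ⟨i, (B.orderEmbOfFin hr).le_iff_le.1 hle, rfl⟩
    · rintro ⟨i, hi, rfl⟩
      exact ⟨Finset.orderEmbOfFin_mem _ _ _, (B.orderEmbOfFin hr).le_iff_le.2 hi⟩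
  rw [this, Finset.card_map, Fin.card_Iic]

/-- The `k`-th boundary point, counted from `0`, is the place where the height along the boundary
increases from `k` to `k + 1`. -/
theorem height_orderEmbOfFin {n : ℕ} {B : Finset ℤ} (hB : B ⊆ Finset.Icc 1 (n : ℤ)) {g : ℤ → ℤ}
    (h0 : g 0 = 0) (hg : ∀ j : ℤ, 1 ≤ j → j ≤ n → g j - g (j - 1) = if j ∈ B then 1 else 0)
    {r : ℕ} (hr : B.card = r) (k : Fin r) :
    (1 ≤ B.orderEmbOfFin hr k ∧ B.orderEmbOfFin hr k ≤ n) ∧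
      g (B.orderEmbOfFin hr k) = k + 1 ∧ g (B.orderEmbOfFin hr k - 1) = k := by
  have hm := Finset.orderEmbOfFin_mem B hr k
  have hc := card_filter_le_orderEmbOfFin hr k
  set x := B.orderEmbOfFin hr k
  have hx := Finset.mem_Icc.1 (hB hm)
  have h1 := eq_card_filter_le hB h0 hg x.toNat (by omega)
  rw [Int.toNat_of_nonneg (by omega), hc] at h1
  have h2 := hg x hx.1 hx.2
  rw [if_pos hm] at h2
  push_cast at h1
  exact ⟨hx, h1, by omega⟩

theorem IsHeight.diag {a b : ℕ} {α β : Finset ℤ} {h : ℤ → ℤ → ℤ} (hh : IsHeight a b α β h) {i j : ℤ}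
    (hi : 1 ≤ i) (hi' : i ≤ a) (hj : 1 ≤ j) (hj' : j ≤ b) :
    h (i - 1) (j - 1) ≤ h i j ∧ h i j ≤ h (i - 1) (j - 1) + 2 := by
  have h1 := hh.right_step i j (by omega) hi' hj hj'
  have h2 := hh.down_step i (j - 1) hi hi' (by omega) (by omega)
  omega

theorem IsHeight.mono {a b : ℕ} {α β : Finset ℤ} {h : ℤ → ℤ → ℤ} (hh : IsHeight a b α β h) (d e : ℕ)
    {i j : ℤ} (hi : 0 ≤ i) (hi' : i + d ≤ a) (hj : 0 ≤ j) (hj' : j + e ≤ b) :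
    h i j ≤ h (i + d) (j + e) := by
  have h1 : h i j ≤ h (i + d) j := by
    induction d with
    | zero => simp
    | succ d ih =>
      push_cast at hi' ⊢
      refine (ih (by omega)).trans ?_
      have := (hh.down_step (i + (d + 1)) j (by omega) hi' hj (by omega)).1
      rwa [show i + ((d : ℤ) + 1) - 1 = i + d by ring] at this
  refine h1.trans ?_
  induction e with
  | zero => simp
  | succ e ih =>
    push_cast at hj' ⊢
    refine (ih (by omega)).trans ?_
    have := (hh.right_step (i + d) (j + (e + 1)) (by omega) hi' (by omega) hj').1
    rwa [show j + ((e : ℤ) + 1) - 1 = j + e by ring] at this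

theorem IsHeight.mono' {a b : ℕ} {α β : Finset ℤ} {h : ℤ → ℤ → ℤ} (hh : IsHeight a b α β h)
    {i j i' j' : ℤ} (hi : 0 ≤ i) (hii : i ≤ i') (hi' : i' ≤ a) (hj : 0 ≤ j) (hjj : j ≤ j')
    (hj' : j' ≤ b) : h i j ≤ h i' j' := by
  have := hh.mono (i' - i).toNat (j' - j).toNat hi (by omega) hj (by omega)
  rwa [show i + ((i' - i).toNat : ℤ) = i' by omega, show j + ((j' - j).toNat : ℤ) = j' by omega]
    at this

/-- The height at the lower right corner is the number of paths. -/
theorem IsHeight.corner {a b : ℕ} {α β : Finset ℤ} {h : ℤ → ℤ → ℤ} (hh : IsHeight a b α β h)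
    (hα : α ⊆ Finset.Icc 1 (a : ℤ)) : h a b = α.card := by
  rw [eq_card_filter_le (g := fun i => h i b) hα (hh.top b (by omega) le_rfl) hh.right a le_rfl]
  congr 2
  exact Finset.filter_true_of_mem fun x hx => (Finset.mem_Icc.1 (hα hx)).2

/-- The number of paths through a point is the height difference along the diagonal, so vacancies
and osculations are the points where this difference is not `1`. -/
theorem mem_vacOsc_iff {a b : ℕ} {α β : Finset ℤ} {h : ℤ → ℤ → ℤ} (hh : IsHeight a b α β h)
    (hα : α ⊆ Finset.Icc 1 (a : ℤ)) {P : Fin α.card → List Point} (hP : IsContour a b P h)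
    (v : Point) : v ∈ vacOsc a b P ↔ v ∈ rect a b ∧ h v.1 v.2 - h (v.1 - 1) (v.2 - 1) ≠ 1 := by
  unfold vacOsc vacancies osculations
  rw [Finset.mem_union, Finset.mem_filter, Finset.mem_filter, ← and_or_left]
  refine and_congr_right fun hv => ?_
  obtain ⟨h1, h2, h3, h4⟩ := mem_rect_iff.1 hv
  obtain ⟨i, j⟩ := v
  simp only at h1 h2 h3 h4 ⊢
  have hd := hh.diag h1 h2 h3 h4
  have hr : h i j ≤ α.card := by
    rw [← hh.corner hα]
    exact hh.mono' (by omega) h2 le_rfl (by omega) h4 le_rfl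
  have h0 : 0 ≤ h (i - 1) (j - 1) := by
    rw [← hh.top 0 le_rfl (by omega)]
    exact hh.mono' le_rfl (by omega) (by omega) le_rfl (by omega) (by omega)
  simp only [hP i j h1 h2 h3 h4]
  constructor
  · rintro (hn | ⟨k, k', hkk, hk, hk'⟩) he
    · exact hn ⟨(h (i - 1) (j - 1)).toNat, by omega⟩ (by simp only; omega)
    · exact hkk (Fin.ext (by omega))
  · intro hne
    by_cases he : h i j = h (i - 1) (j - 1)
    · exact Or.inl fun k => by omega
    · refine Or.inr ⟨⟨(h (i - 1) (j - 1)).toNat, by omega⟩,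
        ⟨(h (i - 1) (j - 1)).toNat + 1, by omega⟩, ?_, ?_, ?_⟩
      · rw [Ne, Fin.mk.injEq]; omega
      · simp only; omega
      · simp only; push_cast; omega

/-! ### From path tuples to height functions -/

section TwoPaths

variable {a b : ℕ} {x y x' y' : ℤ} {p p' : List Point}

/-- Of two osculating paths, the first stays weakly to the upper left of the second. -/
theorem OsculatingPair.fst_le (h : OsculatingPair p p') (hp : p ∈ latticePaths a b x y)
    (hp' : p' ∈ latticePaths a b x' y') (hx : x < x') (hy : y < y') {w w' : Point} (hw : w ∈ p)
    (hw' : w' ∈ p') (hc : content w = content w') : w.1 ≤ w'.1 := by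
  obtain ⟨n, hn⟩ : ∃ n : ℕ, content w' = y' - a + n :=
    ⟨(content w' - (y' - a)).toNat, by
      have := (latticePaths.content_bounds hp' hw').1
      omega⟩
  induction n generalizing w w' with
  | zero =>
    have := latticePaths.eq_of_content hp' hw' (latticePaths.start_mem hp')
      (by rw [hn]; simp [content])
    rw [this]
    exact (latticePaths.bounds hp hw).2.1
  | succ n ih =>
    have hb := latticePaths.content_bounds hp' hw'
    push_cast at hn
    obtain ⟨u', hu', hcu'⟩ := latticePaths.exists_of_content hp' (c := content w' - 1)
      (by omega) (by omega)
    obtain ⟨u, hu, hcu⟩ := latticePaths.exists_of_content hp (c := content w' - 1)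
      (by omega) (by omega)
    have h1 := ih hu hu' (by omega) (by omega)
    have h2 := (latticePaths.step_of_content hp hu hw (by omega)).cases
    have h3 := (latticePaths.step_of_content hp' hu' hw' (by omega)).cases
    by_cases he : u.1 = u'.1
    · -- the paths meet on the previous diagonal, so the first one goes up
      have hu2 : u = u' := by
        unfold content at hcu hcu'
        exact Prod.ext he (by omega)
      subst hu2
      have h4 := (h.mem_of_mem hu hu').2
      have h5 := latticePaths.eq_of_content hp hw h4 (by unfold content at *; simp only; omega)
      rw [h5]
      rcases h3 with h3 | h3
      · rw [h3]; simp only; omega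
      · rw [h3]
    · rcases h2 with h2 | h2 <;> rcases h3 with h3 | h3 <;> rw [h2, h3] <;> simp only <;> omega

/-- If the square to the right of a square lies below the second path, then the square itself lies
below the first. -/
theorem OsculatingPair.exists_of_right (h : OsculatingPair p p') (hp : p ∈ latticePaths a b x y)
    (hp' : p' ∈ latticePaths a b x' y') (hx : x < x') (hy : y < y') {w' : Point} (hw' : w' ∈ p')
    {i j : ℤ} (hi : w'.1 ≤ i) (hc : content w' = content (i, j)) :
    ∃ u ∈ p, content u = content (i, j - 1) ∧ u.1 ≤ i := by
  have hb := latticePaths.content_bounds hp' hw'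
  have hcc : content (i, j - 1) = content w' - 1 := by rw [hc]; unfold content; ring
  rw [hcc]
  obtain ⟨u, hu, hcu⟩ := latticePaths.exists_of_content hp (c := content w' - 1)
      (by omega) (by omega)
  obtain ⟨w, hw, hcw⟩ := latticePaths.exists_of_content hp (c := content w')
      (by omega) (by omega)
  refine ⟨u, hu, hcu, ?_⟩
  have h1 := h.fst_le hp hp' hx hy hw hw' hcw
  have h2 := (latticePaths.step_of_content hp hu hw (by omega)).cases
  by_cases he : w.1 = w'.1
  · have hw2 : w = w' := by
      unfold content at hcw
      exact Prod.ext he (by omega)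
    subst hw2
    have h4 := (h.mem_of_mem hw hw').1
    have h5 := latticePaths.eq_of_content hp hu h4 (by unfold content at *; simp only; omega)
    rw [h5]
    exact hi
  · rcases h2 with h2 | h2 <;> rw [h2] at he h1 <;> simp only at he h1 <;> omega

/-- If the square below a square lies below the second path, then the square itself lies below the
first. -/
theorem OsculatingPair.exists_of_down (h : OsculatingPair p p') (hp : p ∈ latticePaths a b x y)
    (hp' : p' ∈ latticePaths a b x' y') (hx : x < x') (hy : y < y') {w' : Point} (hw' : w' ∈ p')
    {i j : ℤ} (hi : w'.1 ≤ i) (hc : content w' = content (i, j)) :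
    ∃ u ∈ p, content u = content (i - 1, j) ∧ u.1 ≤ i - 1 := by
  have hb := latticePaths.content_bounds hp' hw'
  have hcc : content (i - 1, j) = content w' + 1 := by rw [hc]; unfold content; ring
  rw [hcc]
  obtain ⟨u, hu, hcu⟩ := latticePaths.exists_of_content hp (c := content w' + 1)
      (by omega) (by omega)
  obtain ⟨w, hw, hcw⟩ := latticePaths.exists_of_content hp (c := content w')
      (by omega) (by omega)
  refine ⟨u, hu, hcu, ?_⟩
  have h1 := h.fst_le hp hp' hx hy hw hw' hcw
  have h2 := (latticePaths.step_of_content hp hw hu (by omega)).cases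
  by_cases he : w.1 = w'.1
  · have hw2 : w = w' := by
      unfold content at hcw
      exact Prod.ext he (by omega)
    subst hw2
    have h4 := (h.mem_of_mem hw hw').2
    have h5 := latticePaths.eq_of_content hp hu h4 (by unfold content at *; simp only; omega)
    rw [h5]
    simp only
    omega
  · rcases h2 with h2 | h2 <;> rw [h2] <;> simp only <;> omega

end TwoPaths

/-- A height function is obtained from a downward closed family of regions, one for each path. -/
theorem exists_natCast_lt_iff (D : ℕ → ℤ → ℤ → Prop) (r : ℕ) (hr : ∀ k i j, D k i j → k < r)
    (hD : ∀ k i j, D (k + 1) i j → D k i j) :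
    ∃ h : ℤ → ℤ → ℤ, (∀ i j, 0 ≤ h i j) ∧ ∀ k i j, D k i j ↔ (k : ℤ) < h i j := by
  classical
  have hex : ∀ i j, ∃ k, ¬ D k i j := fun i j => ⟨r, fun h => lt_irrefl _ (hr _ _ _ h)⟩
  refine ⟨fun i j => (Nat.find (hex i j) : ℕ), fun i j => by positivity, fun k i j => ?_⟩
  have hanti : ∀ k d, D (k + d) i j → D k i j := by
    intro k d
    induction d with
    | zero => exact id
    | succ d ih => exact fun h => ih (hD _ _ _ h)
  rw [Nat.cast_lt]
  constructor
  · intro h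
    by_contra hc
    obtain ⟨d, rfl⟩ := Nat.exists_eq_add_of_le (not_lt.1 hc)
    exact Nat.find_spec (hex i j) (hanti _ _ h)
  · intro h
    exact not_not.1 (Nat.find_min (hex i j) h)

theorem exists_isHeight_of_mem_OP {a b : ℕ} {α β : Finset ℤ} {P : Fin α.card → List Point}
    (hP : P ∈ OP a b α β) : ∃ h, IsHeight a b α β h ∧ IsContour a b P h := by
  obtain ⟨hb, hpath, hosc⟩ := hP
  obtain ⟨hα, hβ, hcard⟩ := hb
  simp only at hα hβ hcard
  set A := α.orderEmbOfFin rfl with hA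
  set B := β.orderEmbOfFin hcard with hB
  have hAmem : ∀ k, 1 ≤ A k ∧ A k ≤ a := fun k =>
    Finset.mem_Icc.1 (hα (Finset.orderEmbOfFin_mem _ _ _))
  have hBmem : ∀ k, 1 ≤ B k ∧ B k ≤ b := fun k =>
    Finset.mem_Icc.1 (hβ (Finset.orderEmbOfFin_mem _ _ _))
  have hAlt : ∀ (k : ℕ) (hk : k + 1 < α.card), A ⟨k, by omega⟩ < A ⟨k + 1, hk⟩ := fun k hk =>
    A.strictMono (Fin.lt_def.2 (Nat.lt_succ_self k))
  have hBlt : ∀ (k : ℕ) (hk : k + 1 < α.card), B ⟨k, by omega⟩ < B ⟨k + 1, hk⟩ := fun k hk =>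
    B.strictMono (Fin.lt_def.2 (Nat.lt_succ_self k))
  -- `D k i j`: the unit square to the lower right of `(i, j)` lies below the `k`-th path
  let D : ℕ → ℤ → ℤ → Prop := fun k i j =>
    ∃ hk : k < α.card, ∃ w ∈ P ⟨k, hk⟩, content w = content (i, j) ∧ w.1 ≤ i
  have hdown : ∀ k i j, D (k + 1) i j → D k i j := by
    rintro k i j ⟨hk, w', hw', hc, hi⟩
    have h1 := latticePaths.content_bounds (hpath _) hw'
    have h2 := hAlt k hk
    have h3 := hBlt k hk
    obtain ⟨w, hw, hcw⟩ := latticePaths.exists_of_content (hpath ⟨k, by omega⟩) (c := content w')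
      (by omega) (by omega)
    refine ⟨by omega, w, hw, hcw.trans hc, le_trans ?_ hi⟩
    exact (hosc k hk).fst_le (hpath _) (hpath _) h2 h3 hw hw' hcw
  obtain ⟨h, h0, hD⟩ := exists_natCast_lt_iff D α.card (fun k i j h => h.1) hdown
  have mono_right : ∀ (k : ℕ) (i j : ℤ), 0 ≤ i → j ≤ b → D k i (j - 1) → D k i j := by
    rintro k i j hi hj ⟨hk, w, hw, hc, hle⟩
    have h1 := latticePaths.content_bounds (hpath _) hw
    have hcc : content (i, j) = content w + 1 := by rw [hc]; unfold content; ring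
    refine ⟨hk, ?_⟩
    rw [hcc]
    by_cases he : content w + 1 ≤ b - A ⟨k, hk⟩
    · obtain ⟨u, hu, hcu⟩ := latticePaths.exists_of_content (hpath ⟨k, hk⟩) (c := content w + 1)
        (by omega) he
      refine ⟨u, hu, hcu, ?_⟩
      rcases (latticePaths.step_of_content (hpath _) hw hu hcu).cases with h2 | h2 <;> rw [h2] <;>
        simp only <;> omega
    · exfalso
      have h2 := latticePaths.eq_of_content (hpath _) hw (latticePaths.end_mem (hpath _))
        (by unfold content at *; simp only; omega)
      rw [h2] at hc hle
      unfold content at hc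
      simp only at hc hle
      omega
  have mono_down : ∀ (k : ℕ) (i j : ℤ), i ≤ a → D k (i - 1) j → D k i j := by
    rintro k i j hi ⟨hk, w, hw, hc, hle⟩
    have h1 := latticePaths.content_bounds (hpath _) hw
    have hcc : content (i, j) = content w - 1 := by rw [hc]; unfold content; ring
    refine ⟨hk, ?_⟩
    rw [hcc]
    by_cases he : B ⟨k, hk⟩ - a ≤ content w - 1
    · obtain ⟨u, hu, hcu⟩ := latticePaths.exists_of_content (hpath ⟨k, hk⟩) (c := content w - 1)
        he (by omega)
      refine ⟨u, hu, hcu, ?_⟩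
      rcases (latticePaths.step_of_content (hpath _) hu hw (by omega)).cases with h2 | h2 <;>
        rw [h2] at hle <;> simp only at hle <;> omega
    · exfalso
      have h2 := latticePaths.eq_of_content (hpath _) hw (latticePaths.start_mem (hpath _))
        (by unfold content at *; simp only; omega)
      rw [h2] at hle
      simp only at hle
      omega
  have le_of : ∀ i j i' j', (∀ k, D k i j → D k i' j') → h i j ≤ h i' j' := by
    intro i j i' j' himp
    by_contra hc
    have h1 := h0 i' j'
    have h2 := (hD (h i' j').toNat i' j').1 (himp _ ((hD _ i j).2 (by omega)))
    omega
  have le_succ_of : ∀ i j i' j', (∀ k, D (k + 1) i j → D k i' j') → h i j ≤ h i' j' + 1 := by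
    intro i j i' j' himp
    by_contra hc
    have h1 := h0 i' j'
    have h2 := (hD (h i' j').toNat i' j').1 (himp _ ((hD _ i j).2 (by push_cast; omega)))
    omega
  have hbot : ∀ (j : ℤ) (k : ℕ) (hk : k < α.card), 0 ≤ j → j ≤ b → (D k a j ↔ B ⟨k, hk⟩ ≤ j) := by
    intro j k hk hj hj'
    constructor
    · rintro ⟨_, w, hw, hc, hle⟩
      have := latticePaths.content_bounds (hpath _) hw
      unfold content at *
      simp only at hc
      omega
    · intro hle
      have h1 := hAmem ⟨k, hk⟩
      obtain ⟨w, hw, hcw⟩ := latticePaths.exists_of_content (hpath ⟨k, hk⟩)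
        (c := content ((a : ℤ), j)) (by unfold content; simp only; omega)
        (by unfold content; simp only; omega)
      exact ⟨hk, w, hw, hcw, (latticePaths.bounds (hpath _) hw).2.1⟩
  have hright : ∀ (i : ℤ) (k : ℕ) (hk : k < α.card), 0 ≤ i → i ≤ a → (D k i b ↔ A ⟨k, hk⟩ ≤ i) := by
    intro i k hk hi hi'
    constructor
    · rintro ⟨_, w, hw, hc, hle⟩
      have := latticePaths.bounds (hpath _) hw
      omega
    · intro hle
      have h1 := hBmem ⟨k, hk⟩
      obtain ⟨w, hw, hcw⟩ := latticePaths.exists_of_content (hpath ⟨k, hk⟩)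
        (c := content (i, (b : ℤ))) (by unfold content; simp only; omega)
        (by unfold content; simp only; omega)
      refine ⟨hk, w, hw, hcw, ?_⟩
      have := latticePaths.bounds (hpath _) hw
      unfold content at hcw
      simp only at hcw
      omega
  have hrs : ∀ i j : ℤ, 0 ≤ i → i ≤ a → 1 ≤ j → j ≤ b →
      h i (j - 1) ≤ h i j ∧ h i j ≤ h i (j - 1) + 1 := by
    intro i j hi _ _ hj
    refine ⟨le_of _ _ _ _ fun k => mono_right k i j hi hj, le_succ_of _ _ _ _ ?_⟩
    rintro k ⟨hk, w', hw', hc, hle⟩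
    exact ⟨by omega,
      (hosc k hk).exists_of_right (hpath _) (hpath _) (hAlt k hk) (hBlt k hk) hw' hle hc⟩
  have hds : ∀ i j : ℤ, 1 ≤ i → i ≤ a → 0 ≤ j → j ≤ b →
      h (i - 1) j ≤ h i j ∧ h i j ≤ h (i - 1) j + 1 := by
    intro i j _ hi _ _
    refine ⟨le_of _ _ _ _ fun k => mono_down k i j hi, le_succ_of _ _ _ _ ?_⟩
    rintro k ⟨hk, w', hw', hc, hle⟩
    exact ⟨by omega,
      (hosc k hk).exists_of_down (hpath _) (hpath _) (hAlt k hk) (hBlt k hk) hw' hle hc⟩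
  have hzero : ∀ i j, (∀ k, ¬ D k i j) → h i j = 0 := by
    intro i j hn
    by_contra hc
    have h1 := h0 i j
    exact hn 0 ((hD 0 i j).2 (by push_cast; omega))
  refine ⟨h, ⟨?_, ?_, hrs, hds, ?_, ?_⟩, ?_⟩
  · intro j hj hj'
    refine hzero _ _ ?_
    rintro k ⟨hk, w, hw, hc, hle⟩
    have h1 := latticePaths.bounds (hpath _) hw
    have h2 := (hAmem ⟨k, hk⟩).1
    omega
  · intro i hi hi'
    refine hzero _ _ ?_
    rintro k ⟨hk, w, hw, hc, hle⟩
    have h1 := latticePaths.bounds (hpath _) hw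
    have h2 := (hBmem ⟨k, hk⟩).1
    unfold content at hc
    simp only at hc
    omega
  · intro j hj hj'
    have hs := hrs a j (by omega) le_rfl hj hj'
    have hn := h0 a (j - 1)
    by_cases hm : j ∈ β
    · rw [if_pos hm]
      have : j ∈ Set.range B := by rw [hB, Finset.range_orderEmbOfFin]; exact hm
      obtain ⟨k, rfl⟩ := this
      have h1 := (hD k a (B k)).1 ((hbot _ _ k.isLt (by omega) hj').2 le_rfl)
      have h2 := mt ((hD k a (B k - 1)).2) (fun hc => by
        have := (hbot _ _ k.isLt (by omega) (by omega)).1 hc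
        simp only [Fin.eta] at this
        omega)
      omega
    · rw [if_neg hm]
      by_contra hc
      have h1 := (hD (h a (j - 1)).toNat a j).2 (by omega)
      have h2 := mt ((hD (h a (j - 1)).toNat a (j - 1)).1) (by omega)
      have hk := h1.1
      rw [hbot _ _ hk (by omega) hj'] at h1
      rw [hbot _ _ hk (by omega) (by omega)] at h2
      refine hm ?_
      rw [show j = B ⟨(h a (j - 1)).toNat, hk⟩ by omega]
      exact Finset.orderEmbOfFin_mem _ _ _
  · intro i hi hi'
    have hs := hds i b hi hi' (by omega) le_rfl
    have hn := h0 (i - 1) b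
    by_cases hm : i ∈ α
    · rw [if_pos hm]
      have : i ∈ Set.range A := by rw [hA, Finset.range_orderEmbOfFin]; exact hm
      obtain ⟨k, rfl⟩ := this
      have h1 := (hD k (A k) b).1 ((hright _ _ k.isLt (by omega) hi').2 le_rfl)
      have h2 := mt ((hD k (A k - 1) b).2) (fun hc => by
        have := (hright _ _ k.isLt (by omega) (by omega)).1 hc
        simp only [Fin.eta] at this
        omega)
      omega
    · rw [if_neg hm]
      by_contra hc
      have h1 := (hD (h (i - 1) b).toNat i b).2 (by omega)
      have h2 := mt ((hD (h (i - 1) b).toNat (i - 1) b).1) (by omega)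
      have hk := h1.1
      rw [hright _ _ hk (by omega) hi'] at h1
      rw [hright _ _ hk (by omega) (by omega)] at h2
      refine hm ?_
      rw [show i = A ⟨(h (i - 1) b).toNat, hk⟩ by omega]
      exact Finset.orderEmbOfFin_mem _ _ _
  · intro i j hi hi' hj hj' k
    rw [← hD, ← not_lt, ← hD]
    constructor
    · intro hm
      refine ⟨?_, k.isLt, _, hm, rfl, le_rfl⟩
      rintro ⟨_, w, hw, hc, hle⟩
      have := latticePaths.eq_of_content (hpath _) hw hm
        (by rw [hc]; unfold content; simp only; ring)
      rw [this] at hle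
      simp only at hle
      omega
    · rintro ⟨hn, hk, w, hw, hc, hle⟩
      have : w = (i, j) := by
        by_contra hne
        refine hn ⟨hk, w, hw, by rw [hc]; unfold content; simp only; ring, ?_⟩
        by_contra hc'
        refine hne ?_
        unfold content at hc
        simp only at hc
        exact Prod.ext (by simp only; omega) (by simp only; omega)
      rw [← this]
      exact hw

/-! ### From height functions to path tuples -/

section Contours

variable {a b : ℕ} {α β : Finset ℤ} {h : ℤ → ℤ → ℤ}

/-- `v` is a point of the rectangle at which the height passes from at most `k` to more than `k`
along the diagonal. -/
def OnContour (a b : ℕ) (h : ℤ → ℤ → ℤ) (k : ℤ) (v : Point) : Prop :=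
  v ∈ rect a b ∧ h (v.1 - 1) (v.2 - 1) ≤ k ∧ k < h v.1 v.2

theorem OnContour.eq_of_content (hh : IsHeight a b α β h) {k : ℤ} {v w : Point}
    (hv : OnContour a b h k v) (hw : OnContour a b h k w) (hc : content v = content w) : v = w := by
  have key : ∀ v w : Point, OnContour a b h k v → OnContour a b h k w → content v = content w →
      ¬ v.1 < w.1 := by
    rintro v w ⟨hv, _, hv2⟩ ⟨hw, hw1, _⟩ hc hlt
    rw [mem_rect_iff] at hv hw
    unfold content at hc
    have := hh.mono' (i := v.1) (j := v.2) (i' := w.1 - 1) (j' := w.2 - 1) (by omega) (by omega)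
      (by omega) (by omega) (by omega) (by omega)
    omega
  have h1 := key v w hv hw hc
  have h2 := key w v hw hv hc.symm
  unfold content at hc
  exact Prod.ext (by omega) (by omega)

theorem OnContour.up (hh : IsHeight a b α β h) {k : ℤ} (hk : 0 ≤ k) {v : Point}
    (hv : OnContour a b h k v) (hup : k < h (v.1 - 1) v.2) : OnContour a b h k (v.1 - 1, v.2) := by
  obtain ⟨hr, h1, h2⟩ := hv
  rw [mem_rect_iff] at hr
  have hi : 1 ≤ v.1 - 1 := by
    by_contra hc
    rw [show v.1 - 1 = 0 by omega, hh.top _ (by omega) (by omega)] at hup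
    omega
  have h3 := hh.mono' (i := v.1 - 1 - 1) (j := v.2 - 1) (i' := v.1 - 1) (j' := v.2 - 1)
    (by omega) (by omega) (by omega) (by omega) (by omega) (by omega)
  exact ⟨mem_rect_iff.2 ⟨hi, by simp only; omega, hr.2.2.1, hr.2.2.2⟩, by simp only; omega, hup⟩

theorem OnContour.right (hh : IsHeight a b α β h) {k : ℤ} {v : Point}
    (hv : OnContour a b h k v) (hup : h (v.1 - 1) v.2 ≤ k) (hb : v.2 < b) :
    OnContour a b h k (v.1, v.2 + 1) := by
  obtain ⟨hr, h1, h2⟩ := hv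
  rw [mem_rect_iff] at hr
  have h3 := hh.mono' (i := v.1) (j := v.2) (i' := v.1) (j' := v.2 + 1)
    (by omega) (by omega) (by omega) (by omega) (by omega) (by omega)
  refine ⟨mem_rect_iff.2 ⟨hr.1, hr.2.1, by simp only; omega, by simp only; omega⟩, ?_,
    by simp only; omega⟩
  simp only [add_sub_cancel_right]
  exact hup

/-- Consecutive contour points: the contour goes up exactly if the height above is large. -/
theorem OnContour.next (hh : IsHeight a b α β h) {k : ℤ} (hk : 0 ≤ k) {v w : Point}
    (hv : OnContour a b h k v) (hw : OnContour a b h k w) (hc : content w = content v + 1) :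
    (k < h (v.1 - 1) v.2 ∧ w = (v.1 - 1, v.2)) ∨ (h (v.1 - 1) v.2 ≤ k ∧ w = (v.1, v.2 + 1)) := by
  by_cases hup : k < h (v.1 - 1) v.2
  · refine Or.inl ⟨hup, hw.eq_of_content hh (hv.up hh hk hup) ?_⟩
    rw [hc]; unfold content; simp only; ring
  · rw [not_lt] at hup
    refine Or.inr ⟨hup, ?_⟩
    by_cases hb : v.2 < b
    · refine hw.eq_of_content hh (hv.right hh hup hb) ?_
      rw [hc]; unfold content; simp only; ring
    · exfalso
      obtain ⟨hr, _, _⟩ := hv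
      obtain ⟨hr', _, h2⟩ := hw
      rw [mem_rect_iff] at hr hr'
      unfold content at hc
      have h3 := hh.mono' (i := w.1) (j := w.2) (i' := v.1 - 1) (j' := v.2)
        (by omega) (by omega) (by omega) (by omega) (by omega) (by omega)
      omega

theorem exists_mem_OP_of_isHeight (hh : IsHeight a b α β h) (hb : (α, β) ∈ boundaryPairs a b) :
    ∃ P ∈ OP a b α β, IsContour a b P h := by
  obtain ⟨hα, hβ, hcard⟩ := id hb
  simp only at hα hβ hcard
  set A := α.orderEmbOfFin rfl with hA
  set B := β.orderEmbOfFin hcard with hB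
  have hAk := height_orderEmbOfFin (g := fun i => h i b) hα (hh.top b (by omega) le_rfl)
    hh.right rfl
  have hBk := height_orderEmbOfFin (g := fun j => h a j) hβ (hh.left a (by omega) le_rfl) hh.bottom
    hcard
  simp only [← hA] at hAk
  simp only [← hB] at hBk
  have hrange : ∀ (k : Fin α.card) (v : Point), OnContour a b h (k : ℕ) v →
      B k - a ≤ content v ∧ content v ≤ b - A k := by
    rintro k v ⟨hr, h1, h2⟩
    rw [mem_rect_iff] at hr
    obtain ⟨⟨a1, a2⟩, _, a3⟩ := hAk k
    obtain ⟨⟨b1, b2⟩, _, b3⟩ := hBk k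
    unfold content
    constructor
    · by_contra hc
      have := hh.mono' (i := v.1) (j := v.2) (i' := a) (j' := B k - 1) (by omega) (by omega)
        (by omega) (by omega) (by omega) (by omega)
      omega
    · by_contra hc
      have := hh.mono' (i := v.1) (j := v.2) (i' := A k - 1) (j' := b) (by omega) (by omega)
        (by omega) (by omega) (by omega) (by omega)
      omega
  have hstart : ∀ k : Fin α.card, OnContour a b h (k : ℕ) ((a : ℤ), B k) := by
    intro k
    obtain ⟨⟨a1, a2⟩, _, a3⟩ := hAk k
    obtain ⟨⟨b1, b2⟩, b4, b3⟩ := hBk k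
    refine ⟨mem_rect_iff.2 ⟨by simp only; omega, le_rfl, b1, b2⟩, ?_, by simp only; omega⟩
    have := hh.mono' (i := a - 1) (j := B k - 1) (i' := a) (j' := B k - 1) (by omega) (by omega)
        (by omega) (by omega) (by omega) (by omega)
    simp only
    omega
  have hend : ∀ k : Fin α.card, OnContour a b h (k : ℕ) (A k, (b : ℤ)) := by
    intro k
    obtain ⟨⟨a1, a2⟩, a4, a3⟩ := hAk k
    obtain ⟨⟨b1, b2⟩, b4, b3⟩ := hBk k
    refine ⟨mem_rect_iff.2 ⟨a1, a2, by simp only; omega, le_rfl⟩, ?_, by simp only; omega⟩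
    have := hh.mono' (i := A k - 1) (j := b - 1) (i' := A k - 1) (j' := b) (by omega) (by omega)
        (by omega) (by omega) (by omega) (by omega)
    simp only
    omega
  -- following the contour from its starting point, one meets every diagonal up to the end point
  have hex : ∀ (k : Fin α.card) (n : ℕ), ∃ v : Point, B k - a + n ≤ b - A k →
      OnContour a b h (k : ℕ) v ∧ content v = B k - a + n := by
    intro k n
    induction n with
    | zero => exact ⟨((a : ℤ), B k), fun _ => ⟨hstart k, by unfold content; simp⟩⟩
    | succ n ih =>
      obtain ⟨v, hv⟩ := ih
      by_cases hle : B k - a + ((n + 1 : ℕ) : ℤ) ≤ b - A k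
      · push_cast at hle ⊢
        obtain ⟨hv1, hv2⟩ := hv (by omega)
        by_cases hup : ((k : ℕ) : ℤ) < h (v.1 - 1) v.2
        · refine ⟨_, fun _ => ⟨hv1.up hh (by omega) hup, ?_⟩⟩
          unfold content at *; simp only; omega
        · refine ⟨_, fun _ => ⟨hv1.right hh (by omega) ?_, ?_⟩⟩
          · by_contra hc
            obtain ⟨hr, h1, h2⟩ := hv1
            rw [mem_rect_iff] at hr
            obtain ⟨⟨a1, a2⟩, a4, a3⟩ := hAk k
            unfold content at hv2
            have := hh.mono' (i := A k) (j := b) (i' := v.1 - 1) (j' := v.2) (by omega) (by omega)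
              (by omega) (by omega) (by omega) (by omega)
            omega
          · unfold content at *; simp only; omega
      · exact ⟨v, fun h => absurd h hle⟩
  choose F hF using hex
  let len : Fin α.card → ℕ := fun k => (b - A k - (B k - a) + 1).toNat
  let P : Fin α.card → List Point := fun k => (List.range (len k)).map (F k)
  have hlen : ∀ k, (P k).length = len k := fun k => by simp [P]
  have hget : ∀ k (m : ℕ) (v : Point),
      (P k)[m]? = some v ↔ OnContour a b h (k : ℕ) v ∧ content v = B k - a + m := by
    intro k m v
    constructor
    · intro hm
      have hlt := (List.getElem?_eq_some_iff.1 hm).1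
      rw [hlen] at hlt
      simp only [P, List.getElem?_map, List.getElem?_range hlt, Option.map_some,
        Option.some_inj] at hm
      subst hm
      exact hF k m (by simp only [len] at hlt; omega)
    · rintro ⟨hv, hc⟩
      have hr := hrange k v hv
      have hlt : m < len k := by simp only [len]; omega
      simp only [P, List.getElem?_map, List.getElem?_range hlt, Option.map_some,
        Option.some_inj]
      have := hF k m (by omega)
      exact this.1.eq_of_content hh hv (by rw [this.2, hc])
  have hmem : ∀ k v, v ∈ P k ↔ OnContour a b h (k : ℕ) v := by
    intro k v
    rw [List.mem_iff_getElem?]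
    constructor
    · rintro ⟨m, hm⟩
      exact ((hget k m v).1 hm).1
    · intro hv
      have hr := hrange k v hv
      exact ⟨(content v - (B k - a)).toNat, (hget _ _ _).2 ⟨hv, by omega⟩⟩
  refine ⟨P, ⟨hb, fun k => ⟨?_, ?_, ?_⟩, ?_⟩, ?_⟩
  · rw [List.head?_eq_getElem?, hget]
    exact ⟨hstart k, by unfold content; simp [hB]⟩
  · rw [List.getLast?_eq_getElem?, hget, hlen]
    refine ⟨hend k, ?_⟩
    have := hrange k _ (hend k)
    change content (A k, (b : ℤ)) = B k - a + ((len k - 1 : ℕ) : ℤ)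
    unfold content at *
    simp only [len] at *
    omega
  · rw [List.isChain_iff_getElem]
    intro m hm
    have h1 := (hget k m _).1 (List.getElem?_eq_getElem (by omega))
    have h2 := (hget k (m + 1) _).1 (List.getElem?_eq_getElem hm)
    have h3 := h1.1.next hh (by omega) h2.1 (by rw [h1.2, h2.2]; push_cast; ring)
    unfold Step
    rcases h3 with ⟨_, h3⟩ | ⟨_, h3⟩ <;> rw [h3]
    · right; ext <;> simp
    · left; ext <;> simp
  · intro k hk m m' i j hm hm'
    obtain ⟨⟨hr, hv1, hv2⟩, hc⟩ := (hget _ _ _).1 hm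
    obtain ⟨hv', hc'⟩ := (hget _ _ _).1 hm'
    obtain ⟨_, hv3, hv4⟩ := id hv'
    obtain ⟨hi1, hi2, hj1, hj2⟩ := mem_rect_iff.1 hr
    simp only at hv1 hv2 hv3 hv4 hc hc' hi1 hi2 hj1 hj2
    push_cast at hv3 hv4
    -- two contours meet at `(i, j)`, which determines the four heights around this point
    have r1 := hh.right_step i j (by omega) hi2 hj1 hj2
    have r2 := hh.right_step (i - 1) j (by omega) (by omega) hj1 hj2
    have d1 := hh.down_step i j hi1 hi2 (by omega) hj2
    have d2 := hh.down_step i (j - 1) hi1 hi2 (by omega) (by omega)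
    have hj3 : 1 ≤ j - 1 := by
      by_contra hcon
      rw [show j - 1 = 0 by omega, hh.left i (by omega) hi2] at r1
      omega
    have hleft : OnContour a b h (k : ℤ) (i, j - 1) := by
      refine ⟨mem_rect_iff.2 ⟨hi1, hi2, hj3, by simp only; omega⟩, ?_, by simp only; omega⟩
      have := hh.right_step (i - 1) (j - 1) (by omega) (by omega) hj3 (by omega)
      simp only
      omega
    have hrl := hrange ⟨k, by omega⟩ _ hleft
    have hup := OnContour.up hh (k := k) (by omega) (v := (i, j))
      ⟨hr, by simp only; omega, by simp only; omega⟩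
      (by simp only; omega)
    refine ⟨⟨?_, (hget _ _ _).2 ⟨hleft, ?_⟩⟩, (hget _ _ _).2 ⟨hup, ?_⟩,
      fun hm0 => ?_, fun hml => ?_⟩
    · unfold content at *; simp only at *; omega
    · unfold content at *; simp only at *; omega
    · unfold content at *; simp only at *; push_cast; omega
    · have hlt := (List.getElem?_eq_some_iff.1 hm').1
      have e : (P ⟨k + 1, hk⟩)[m' - 1]? = some (P ⟨k + 1, hk⟩)[m' - 1] :=
        List.getElem?_eq_getElem (by omega)
      have hu := (hget _ _ _).1 e
      rw [e]
      set u := (P ⟨k + 1, hk⟩)[m' - 1]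
      have h3 := hu.1.next hh (by positivity) hv' (by rw [hc', hu.2]; omega)
      simp only [Prod.mk.injEq] at h3
      rcases h3 with ⟨_, e1, e2⟩ | ⟨_, e1, e2⟩
      · congr 1
        exact Prod.ext (by simp only; omega) (by simp only; omega)
      · exfalso
        have h4 := hu.1.2.2
        rw [show u.1 = i by omega, show u.2 = j - 1 by omega] at h4
        push_cast at h4
        omega
    · have hlt := (List.getElem?_eq_some_iff.1 hm').1
      have e : (P ⟨k + 1, hk⟩)[m' + 1]? = some (P ⟨k + 1, hk⟩)[m' + 1] :=
        List.getElem?_eq_getElem (by omega)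
      have hu := (hget _ _ _).1 e
      rw [e]
      set u := (P ⟨k + 1, hk⟩)[m' + 1]
      have h3 := hv'.next hh (by positivity) hu.1 (by rw [hc', hu.2]; push_cast; ring)
      rcases h3 with ⟨h4, _⟩ | ⟨_, h3⟩
      · exfalso
        simp only at h4
        push_cast at h4
        omega
      · rw [h3]
  · intro i j hi hi' hj hj' k
    rw [hmem]
    exact ⟨fun hv => hv.2, fun hv => ⟨mem_rect_iff.2 ⟨hi, hi', hj, hj'⟩, hv⟩⟩

end Contours

/-! ### The boundary point pair of a partition -/

/-- The edge states of a partition are its Maya diagram `{λ_i - i + 1 : i ≥ 1}`. -/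
theorem edge_diagCount_eq_one_iff (μ : YoungDiagram) (p : ℤ) :
    edge (diagCount μ) p = 1 ↔ ∃ i : ℕ, p = (μ.rowLen i : ℤ) - i := by
  have h1 := diagCount_nonneg μ p
  have h2 := diagCount_nonneg μ (p - 1)
  constructor
  · intro h
    have hr : ∀ j : ℕ, _ := fun j =>
      mem_iff_lt_diagCount μ (diagCell p (diagCount μ p).toNat).1 j
    refine ⟨(diagCell p (diagCount μ p).toNat).1, ?_⟩
    set i := (diagCell p (diagCount μ p).toNat).1 with hi
    simp only [diagCell] at hi
    have e1 := hr (p + i).toNat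
    have e2 := hr (p + i - 1).toNat
    rw [YoungDiagram.mem_iff_lt_rowLen] at e1 e2
    rw [show ((p + i).toNat : ℤ) - i = p by omega] at e1
    unfold edge at h
    by_cases hz : p + i = 0
    · omega
    · rw [show ((p + i - 1).toNat : ℤ) - i = p - 1 by omega] at e2
      split_ifs at h <;> omega
  · rintro ⟨i, hi⟩
    have e1 := mem_iff_lt_diagCount μ i (μ.rowLen i)
    rw [YoungDiagram.mem_iff_lt_rowLen, ← hi] at e1
    have e3 := edge_diagCount μ p
    unfold edge at e3 ⊢
    by_cases hz : μ.rowLen i = 0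
    · rw [if_pos (by omega)] at e3 ⊢
      omega
    · have e2 := mem_iff_lt_diagCount μ i (μ.rowLen i - 1)
      rw [YoungDiagram.mem_iff_lt_rowLen,
        show ((μ.rowLen i - 1 : ℕ) : ℤ) - i = p - 1 by omega] at e2
      split_ifs at e3 ⊢ <;> omega

theorem diagCount_eq_zero_of_mem_Par {a b : ℕ} {lam : YoungDiagram} (h : lam ∈ Par a b) {c : ℤ}
    (hc : c ≤ -a ∨ b ≤ c) : diagCount lam c = 0 := by
  obtain ⟨h1, h2⟩ := h
  by_contra hne
  have h0 := diagCount_nonneg lam c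
  have hm := (diagCell_mem_iff lam c 0).2 (by push_cast; omega)
  simp only [diagCell] at hm
  have r1 := YoungDiagram.mem_iff_lt_rowLen.1 (lam.up_left_mem (Nat.zero_le _) le_rfl hm)
  have r2 := YoungDiagram.mem_iff_lt_colLen.1 (lam.up_left_mem le_rfl (Nat.zero_le _) hm)
  omega

theorem mem_complement_iff {a b : ℕ} {lam : YoungDiagram} {i j : ℕ} :
    (i, j) ∈ complement a b lam ↔ i < a ∧ j < b ∧ (a - 1 - i, b - 1 - j) ∉ lam := by
  rw [← YoungDiagram.mem_cells, ← YoungDiagram.mem_cells]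
  simp [complement, and_assoc]

theorem rowLen_complement {a b : ℕ} {lam : YoungDiagram} (h : lam ∈ Par a b) {i : ℕ} (hi : i < a) :
    (complement a b lam).rowLen i = b - lam.rowLen (a - 1 - i) := by
  have hle : lam.rowLen (a - 1 - i) ≤ b := (lam.rowLen_anti _ _ (Nat.zero_le _)).trans h.2
  have key : ∀ j, j < (complement a b lam).rowLen i ↔ j < b - lam.rowLen (a - 1 - i) := by
    intro j
    rw [← YoungDiagram.mem_iff_lt_rowLen, mem_complement_iff, YoungDiagram.mem_iff_lt_rowLen]
    omega
  have h1 := key (b - lam.rowLen (a - 1 - i))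
  have h2 := key ((complement a b lam).rowLen i)
  omega

theorem lt_rank_iff {μ : YoungDiagram} {i : ℕ} : i < rank μ ↔ (i, i) ∈ μ := by
  rw [mem_iff_lt_diagCount, sub_self]
  have : diagCount μ 0 = rank μ := by
    unfold diagCount rank
    congr 2
    ext x
    simp only [Finset.mem_filter]
    refine and_congr_right fun _ => ?_
    omega
  rw [this]
  omega

theorem mem_betaOf_iff {a b : ℕ} {lam : YoungDiagram} (h : lam ∈ Par a b) (j : ℤ) :
    j ∈ betaOf a b lam ↔ (1 ≤ j ∧ j ≤ b) ∧ edge (diagCount lam) (j - a) = 1 := by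
  unfold betaOf frobArm
  rw [Finset.mem_image, edge_diagCount_eq_one_iff]
  constructor
  · rintro ⟨i, hi, rfl⟩
    rw [Finset.mem_range, lt_rank_iff] at hi
    have hi' := YoungDiagram.mem_iff_lt_rowLen.1 hi
    obtain ⟨h1, h2, _⟩ := mem_complement_iff.1 hi
    rw [rowLen_complement h h1] at hi' ⊢
    exact ⟨by omega, a - 1 - i, by omega⟩
  · rintro ⟨⟨h1, h2⟩, i, hi⟩
    have hia : i < a := by
      by_contra hc
      have : lam.rowLen i = 0 := by
        by_contra hne
        have hm := YoungDiagram.mem_iff_lt_rowLen.2 (Nat.pos_of_ne_zero hne)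
        have := YoungDiagram.mem_iff_lt_colLen.1 hm
        have := h.1
        omega
      omega
    have hrow := rowLen_complement h (i := a - 1 - i) (by omega)
    rw [show a - 1 - (a - 1 - i) = i by omega] at hrow
    refine ⟨a - 1 - i, ?_, by omega⟩
    rw [Finset.mem_range, lt_rank_iff, YoungDiagram.mem_iff_lt_rowLen]
    omega

theorem complement_transpose (a b : ℕ) (lam : YoungDiagram) :
    complement b a lam.transpose = (complement a b lam).transpose := by
  ext ⟨i, j⟩
  rw [YoungDiagram.mem_cells, YoungDiagram.mem_cells, YoungDiagram.mem_transpose,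
    mem_complement_iff, YoungDiagram.mem_transpose, Prod.swap_prod_mk, Prod.swap_prod_mk,
    mem_complement_iff]
  tauto

theorem rank_transpose (μ : YoungDiagram) : rank μ.transpose = rank μ := by
  have h : ∀ i, i < rank μ.transpose ↔ i < rank μ := by
    intro i
    rw [lt_rank_iff, lt_rank_iff, YoungDiagram.mem_transpose, Prod.swap_prod_mk]
  have h1 := h (rank μ)
  have h2 := h (rank μ.transpose)
  omega

theorem alphaOf_eq_betaOf_transpose (a b : ℕ) (lam : YoungDiagram) :
    alphaOf a b lam = betaOf b a lam.transpose := by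
  unfold alphaOf betaOf frobLeg frobArm
  rw [complement_transpose, rank_transpose]
  simp only [YoungDiagram.rowLen_transpose]

theorem transpose_mem_Par {a b : ℕ} {lam : YoungDiagram} (h : lam ∈ Par a b) :
    lam.transpose ∈ Par b a := by
  refine ⟨?_, ?_⟩
  · rw [YoungDiagram.colLen_transpose]; exact h.2
  · rw [YoungDiagram.rowLen_transpose]; exact h.1

theorem diagCount_transpose (μ : YoungDiagram) (c : ℤ) :
    diagCount μ.transpose c = diagCount μ (-c) := by
  have key : ∀ m : ℕ, (m : ℤ) < diagCount μ.transpose c ↔ (m : ℤ) < diagCount μ (-c) := by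
    intro m
    rw [← diagCell_mem_iff, ← diagCell_mem_iff, YoungDiagram.mem_transpose]
    unfold diagCell
    rw [Prod.swap_prod_mk, neg_neg]
  have h1 := diagCount_nonneg μ.transpose c
  have h2 := diagCount_nonneg μ (-c)
  have e1 := key (diagCount μ.transpose c).toNat
  have e2 := key (diagCount μ (-c)).toNat
  omega

theorem mem_alphaOf_iff {a b : ℕ} {lam : YoungDiagram} (h : lam ∈ Par a b) (i : ℤ) :
    i ∈ alphaOf a b lam ↔ (1 ≤ i ∧ i ≤ a) ∧ edge (diagCount lam) (b + 1 - i) = 0 := by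
  rw [alphaOf_eq_betaOf_transpose, mem_betaOf_iff (transpose_mem_Par h)]
  refine and_congr_right fun _ => ?_
  unfold edge
  rw [diagCount_transpose, diagCount_transpose, show -(i - (b : ℤ) - 1) = b + 1 - i by ring,
    show -(i - (b : ℤ)) = b + 1 - i - 1 by ring]
  split_ifs <;> omega

theorem card_betaOf {a b : ℕ} {lam : YoungDiagram} :
    (betaOf a b lam).card = rank (complement a b lam) := by
  unfold betaOf
  rw [Finset.card_image_of_injective, Finset.card_range]
  refine StrictMono.injective fun i j hij => ?_
  have := (complement a b lam).rowLen_anti i j hij.le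
  unfold frobArm
  omega

theorem boundaryPair_mem {a b : ℕ} {lam : YoungDiagram} (h : lam ∈ Par a b) :
    (alphaOf a b lam, betaOf a b lam) ∈ boundaryPairs a b := by
  refine ⟨fun i hi => Finset.mem_Icc.2 ((mem_alphaOf_iff h i).1 hi).1,
    fun j hj => Finset.mem_Icc.2 ((mem_betaOf_iff h j).1 hj).1, ?_⟩
  simp only
  rw [alphaOf_eq_betaOf_transpose, card_betaOf, card_betaOf, complement_transpose, rank_transpose]

/-- The heights on the lower boundary are determined by the partition. -/
theorem IsHeight.bottom_eq {a b : ℕ} {lam : YoungDiagram} (hlam : lam ∈ Par a b) {h : ℤ → ℤ → ℤ}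
    (hh : IsHeight a b (alphaOf a b lam) (betaOf a b lam) h) (j : ℕ) (hj : j ≤ b) :
    h a j = min (a : ℤ) j - diagCount lam (j - a) := by
  induction j with
  | zero =>
    rw [Nat.cast_zero, hh.left a (by omega) le_rfl,
      diagCount_eq_zero_of_mem_Par hlam (Or.inl (by omega))]
    omega
  | succ j ih =>
    have h1 := hh.bottom (j + 1 : ℕ) (by push_cast; omega) (by exact_mod_cast hj)
    rw [show ((j + 1 : ℕ) : ℤ) - 1 = j by push_cast; ring, ih (by omega)] at h1
    have h2 := mem_betaOf_iff hlam ((j + 1 : ℕ) : ℤ)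
    have h3 := edge_diagCount lam (((j + 1 : ℕ) : ℤ) - a)
    have h4 : 1 ≤ ((j + 1 : ℕ) : ℤ) ∧ ((j + 1 : ℕ) : ℤ) ≤ b := by omega
    simp only [h4, true_and] at h2
    simp only [h2] at h1
    unfold edge at h1 h3
    rw [show ((j + 1 : ℕ) : ℤ) - a - 1 = j - a by push_cast; ring] at h1 h3
    split_ifs at h1 h3 <;> omega

/-- The heights on the right boundary are determined by the partition. -/
theorem IsHeight.right_eq {a b : ℕ} {lam : YoungDiagram} (hlam : lam ∈ Par a b) {h : ℤ → ℤ → ℤ}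
    (hh : IsHeight a b (alphaOf a b lam) (betaOf a b lam) h) (i : ℕ) (hi : i ≤ a) :
    h i b = min (i : ℤ) b - diagCount lam (b - i) := by
  induction i with
  | zero =>
    rw [Nat.cast_zero, hh.top b (by omega) le_rfl,
      diagCount_eq_zero_of_mem_Par hlam (Or.inr (by omega))]
    omega
  | succ i ih =>
    have h1 := hh.right (i + 1 : ℕ) (by push_cast; omega) (by exact_mod_cast hi)
    rw [show ((i + 1 : ℕ) : ℤ) - 1 = i by push_cast; ring, ih (by omega)] at h1
    have h2 := mem_alphaOf_iff hlam ((i + 1 : ℕ) : ℤ)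
    have h3 := edge_diagCount lam (b + 1 - ((i + 1 : ℕ) : ℤ))
    have h4 : 1 ≤ ((i + 1 : ℕ) : ℤ) ∧ ((i + 1 : ℕ) : ℤ) ≤ a := by omega
    simp only [h4, true_and] at h2
    simp only [h2] at h1
    unfold edge at h1 h3
    rw [show (b : ℤ) + 1 - ((i + 1 : ℕ) : ℤ) - 1 = b - ((i + 1 : ℕ) : ℤ) by ring,
      show (b : ℤ) + 1 - ((i + 1 : ℕ) : ℤ) = b - i by push_cast; ring] at h1 h3
    split_ifs at h1 h3 <;> omega

/-! ### Vacancy-osculation sets and oscillating tableaux -/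

section Correspondence

variable {q : ℤ} {prec : ℤ → ℤ → Prop} {l : ℕ} {s : Fin l → Point} {ε : Fin l → ℤ} {a b : ℕ}
  {lam : YoungDiagram}

theorem height_sub_diag (v : Point) : height s ε v - height s ε (v.1 - 1, v.2 - 1) =
    1 - ∑ i, if s i = v then ε i else 0 := by
  unfold height
  have : ∑ i, (if content (s i) = content v ∧ (s i).1 ≤ v.1 then ε i else 0) =
      ∑ i, (if content (s i) = content (v.1 - 1, v.2 - 1) ∧ (s i).1 ≤ (v.1 - 1, v.2 - 1).1
        then ε i else 0) + ∑ i, if s i = v then ε i else 0 := by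
    rw [← Finset.sum_add_distrib]
    refine Finset.sum_congr rfl fun i _ => ?_
    have hc : content (v.1 - 1, v.2 - 1) = content v := by unfold content; ring
    rw [hc]
    by_cases he : s i = v
    · simp [he]
    · have he' : content (s i) = content v → (s i).1 ≠ v.1 := by
        intro h1 h2
        unfold content at h1
        exact he (Prod.ext h2 (by omega))
      have : (content (s i) = content v ∧ (s i).1 ≤ v.1) ↔
          (content (s i) = content v ∧ (s i).1 ≤ v.1 - 1) := by
        constructor
        · rintro ⟨h1, h2⟩; have := he' h1; exact ⟨h1, by omega⟩
        · rintro ⟨h1, h2⟩; exact ⟨h1, by omega⟩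
      simp only [this, he, if_false, add_zero]
  rw [this]
  simp only
  omega

theorem sum_ite_eq_of_injective (hs : Function.Injective s) (k : Fin l) :
    (∑ i, if s i = s k then ε i else 0) = ε k := by
  simp [hs.eq_iff]

theorem height_eq_zero (hrect : ∀ i, s i ∈ rect a b) {v : Point}
    (hv : v.1 = 0 ∧ 0 ≤ v.2 ∨ v.2 = 0 ∧ 0 ≤ v.1) :
    height s ε v = 0 := by
  unfold height
  rw [Finset.sum_eq_zero]
  · omega
  · rintro i -
    refine if_neg ?_
    rintro ⟨h1, h2⟩
    have := mem_rect_iff.1 (hrect i)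
    unfold content at h1
    omega

/-- At the far end of a diagonal, the height is determined by the last partition. -/
theorem height_last (hrect : ∀ i, s i ∈ rect a b) {v : Point} (hv : v.1 = a ∨ v.2 = b) :
    height s ε v = min v.1 v.2 - partialCount (fun i => content (s i)) ε l (content v) := by
  unfold height
  rw [partialCount_last]
  congr 1
  refine Finset.sum_congr rfl fun i _ => ?_
  congr 1
  rw [eq_iff_iff, and_iff_left_iff_imp]
  intro h
  have := mem_rect_iff.1 (hrect i)
  unfold content at h
  omega

theorem isHeight_height (hq : IsQOrder q prec) (hs : ∀ k k', k < k' → Before q prec (s k) (s k'))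
    (hrect : ∀ i, s i ∈ rect a b) (hlam : lam ∈ Par a b)
    (hedge : ∀ k ≤ l, ∀ p, edge (partialCount (fun i => content (s i)) ε k) p = 0 ∨
      edge (partialCount (fun i => content (s i)) ε k) p = 1)
    (hlast : diagCount lam = partialCount (fun i => content (s i)) ε l) :
    IsHeight a b (alphaOf a b lam) (betaOf a b lam) fun i j => height s ε (i, j) := by
  have hinc := height_increments hq hs hedge
  refine ⟨fun j hj _ => height_eq_zero hrect (Or.inl ⟨rfl, hj⟩),
    fun i hi _ => height_eq_zero hrect (Or.inr ⟨rfl, hi⟩), ?_, ?_, ?_, ?_⟩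
  · intro i j _ _ _ _
    have := (hinc (i, j)).1
    simp only at this
    omega
  · intro i j _ _ _ _
    have := (hinc (i, j)).2
    simp only at this
    omega
  · intro j hj hj'
    rw [height_last hrect (Or.inl rfl), height_last hrect (Or.inl rfl), ← hlast]
    have h2 := mem_betaOf_iff hlam j
    simp only [hj, hj', true_and] at h2
    simp only [h2]
    have h3 := edge_diagCount lam (j - a)
    unfold edge at h3 ⊢
    unfold content
    simp only
    rw [show j - 1 - (a : ℤ) = j - a - 1 by ring]
    split_ifs at h3 ⊢ <;> omega
  · intro i hi hi'
    rw [height_last hrect (Or.inr rfl), height_last hrect (Or.inr rfl), ← hlast]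
    have h2 := mem_alphaOf_iff hlam i
    simp only [hi, hi', true_and] at h2
    simp only [h2]
    have h3 := edge_diagCount lam (b + 1 - i)
    unfold edge at h3 ⊢
    unfold content
    simp only
    rw [show (b : ℤ) + 1 - i - 1 = b - i by ring, show (b : ℤ) - (i - 1) = b + 1 - i by ring] at *
    split_ifs at h3 ⊢ <;> omega

/-- The points of an oscillating tableau, if they lie in the rectangle and increase in the total
order, form a vacancy-osculation set. -/
theorem image_mem_VOS (hq : IsQOrder q prec) (hs : ∀ k k', k < k' → Before q prec (s k) (s k'))
    (hrect : ∀ i, s i ∈ rect a b) (hlam : lam ∈ Par a b) {η : Fin (l + 1) → YoungDiagram}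
    (hη : η ∈ OT lam l) (hprof : ∀ i, profile η i = content (s i)) :
    Finset.univ.image s ∈ VOS a b (alphaOf a b lam) (betaOf a b lam) l := by
  obtain ⟨ε, hε, hN⟩ := hη.1.exists_signs
  rw [show profile η = fun i => content (s i) from funext hprof] at hN
  have hinj : Function.Injective s :=
    ((isInducedOrdering_iff hq _ s).2 ⟨hs, rfl⟩).1
  have hlast : diagCount lam = partialCount (fun i => content (s i)) ε l := by
    rw [← hη.2, hN]; rfl
  have hedge : ∀ k ≤ l, ∀ p, edge (partialCount (fun i => content (s i)) ε k) p = 0 ∨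
      edge (partialCount (fun i => content (s i)) ε k) p = 1 := by
    intro k hk p
    have := edge_diagCount (η ⟨k, Nat.lt_succ_of_le hk⟩) p
    rwa [hN] at this
  have hh := isHeight_height hq hs hrect hlam hedge hlast
  have hb := boundaryPair_mem hlam
  obtain ⟨P, hP, hcont⟩ := exists_mem_OP_of_isHeight hh hb
  have hZ : vacOsc a b P = Finset.univ.image s := by
    ext v
    rw [mem_vacOsc_iff hh hb.1 hcont, Finset.mem_image]
    rw [height_sub_diag]
    constructor
    · rintro ⟨_, hne⟩
      by_contra hc
      refine hne ?_
      rw [Finset.sum_eq_zero, sub_zero]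
      intro i hi
      exact if_neg fun he => hc ⟨i, hi, he⟩
    · rintro ⟨i, _, rfl⟩
      rw [sum_ite_eq_of_injective hinj]
      have := hε i
      exact ⟨hrect i, by omega⟩
  refine ⟨P, hP, ?_, hZ⟩
  rw [hZ, Finset.card_image_of_injective _ hinj, Finset.card_univ, Fintype.card_fin]

/-- Two height functions with the same diagonal increments agree. -/
theorem height_eq_of_isHeight {α β : Finset ℤ} {h : ℤ → ℤ → ℤ} (hh : IsHeight a b α β h)
    (hrect : ∀ i, s i ∈ rect a b)
    (hd : ∀ v ∈ rect a b, h v.1 v.2 - h (v.1 - 1) (v.2 - 1) = 1 - ∑ i, if s i = v then ε i else 0)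
    {i j : ℤ} (hi : 0 ≤ i) (hi' : i ≤ a) (hj : 0 ≤ j) (hj' : j ≤ b) :
    h i j = height s ε (i, j) := by
  obtain ⟨m, hm⟩ : ∃ m : ℕ, min i j = m := ⟨(min i j).toNat, by omega⟩
  induction m generalizing i j with
  | zero =>
    by_cases h0 : i = 0
    · subst h0
      rw [hh.top j hj hj', height_eq_zero hrect (Or.inl ⟨rfl, hj⟩)]
    · have h0 : j = 0 := by omega
      subst h0
      rw [hh.left i hi hi', height_eq_zero hrect (Or.inr ⟨rfl, hi⟩)]
  | succ m ih =>
    push_cast at hm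
    have h1 := ih (i := i - 1) (j := j - 1) (by omega) (by omega) (by omega) (by omega) (by omega)
    have h2 := hd (i, j) (mem_rect_iff.2 ⟨by simp only; omega, hi', by simp only; omega, hj'⟩)
    have h3 := height_sub_diag (s := s) (ε := ε) (i, j)
    simp only at h2 h3
    omega

/-- A vacancy-osculation set, listed in the total order, has an associated oscillating tableau of
the shape given by the boundary points. -/
theorem exists_tableau_of_mem_VOS (hq : IsQOrder q prec) (hlam : lam ∈ Par a b) {S : Finset Point}
    (hS : S ∈ VOS a b (alphaOf a b lam) (betaOf a b lam) l)
    (hs : ∀ k k', k < k' → Before q prec (s k) (s k')) (himg : Finset.univ.image s = S) :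
    (∀ i, s i ∈ rect a b) ∧ ∃ η ∈ OT lam l, ∀ i, profile η i = content (s i) := by
  obtain ⟨P, hP, hcard, hZ⟩ := hS
  obtain ⟨h, hh, hcont⟩ := exists_isHeight_of_mem_OP hP
  have hb := boundaryPair_mem hlam
  have hinj : Function.Injective s := ((isInducedOrdering_iff hq _ s).2 ⟨hs, rfl⟩).1
  have hmem : ∀ v, (∃ i, s i = v) ↔
      v ∈ rect a b ∧ h v.1 v.2 - h (v.1 - 1) (v.2 - 1) ≠ 1 := by
    intro v
    rw [← mem_vacOsc_iff hh hb.1 hcont, hZ, ← himg, Finset.mem_image]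
    simp
  have hrect : ∀ i, s i ∈ rect a b := fun i => ((hmem _).1 ⟨i, rfl⟩).1
  refine ⟨hrect, ?_⟩
  -- vacancies have sign `1`, osculations sign `-1`
  let ε : Fin l → ℤ := fun i => 1 - (h (s i).1 (s i).2 - h ((s i).1 - 1) ((s i).2 - 1))
  have hε : ∀ i, ε i = 1 ∨ ε i = -1 := by
    intro i
    have h1 := ((hmem _).1 ⟨i, rfl⟩).2
    obtain ⟨r1, r2, r3, r4⟩ := mem_rect_iff.1 (hrect i)
    have h2 := hh.diag r1 r2 r3 r4
    simp only [ε]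
    omega
  have hd : ∀ v ∈ rect a b, h v.1 v.2 - h (v.1 - 1) (v.2 - 1) =
      1 - ∑ i, if s i = v then ε i else 0 := by
    intro v hv
    by_cases he : ∃ i, s i = v
    · obtain ⟨i, rfl⟩ := he
      rw [sum_ite_eq_of_injective hinj]
      simp only [ε]
      ring
    · have h1 := mt (hmem v).2 he
      rw [Finset.sum_eq_zero fun i _ => if_neg fun h => he ⟨i, h⟩, sub_zero]
      by_contra hc
      exact h1 ⟨hv, hc⟩
  have heq : ∀ i j : ℤ, 0 ≤ i → i ≤ a → 0 ≤ j → j ≤ b → h i j = height s ε (i, j) :=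
    fun i j h1 h2 h3 h4 => height_eq_of_isHeight hh hrect hd h1 h2 h3 h4
  have hedge := edge_partialCount_of_height (ε := ε) hq hs (fun i => by
    obtain ⟨r1, r2, r3, r4⟩ := mem_rect_iff.1 (hrect i)
    have e1 := heq (s i).1 (s i).2 (by omega) r2 (by omega) r4
    have e2 := heq (s i).1 ((s i).2 - 1) (by omega) r2 (by omega) (by omega)
    have e3 := heq ((s i).1 - 1) (s i).2 (by omega) (by omega) (by omega) r4
    rw [Prod.mk.eta] at e1
    rw [← e1, ← e2, ← e3]
    have h1 := hh.right_step (s i).1 (s i).2 (by omega) r2 r3 r4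
    have h2 := hh.down_step (s i).1 (s i).2 r1 r2 (by omega) r4
    omega)
  obtain ⟨η, hη, hprof, hN⟩ := exists_isOscillating (fun i => content (s i)) ε hε hedge
  refine ⟨η, ⟨hη, diagCount_injective (funext fun c => ?_)⟩, congrFun hprof⟩
  rw [hN, Fin.val_last]
  by_cases hout : c ≤ -a ∨ b ≤ c
  · rw [diagCount_eq_zero_of_mem_Par hlam hout, partialCount_eq_zero]
    intro i _ hi
    have := mem_rect_iff.1 (hrect i)
    unfold content at hi
    omega
  · by_cases hcc : c ≤ b - a
    · have h1 := height_last (ε := ε) hrect (v := ((a : ℤ), a + c)) (Or.inl rfl)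
      have h2 := hh.bottom_eq hlam (a + c).toNat (by omega)
      rw [show (((a + c).toNat : ℕ) : ℤ) = a + c by omega,
        heq _ _ (by omega) le_rfl (by omega) (by omega), h1] at h2
      unfold content at h2
      simp only [add_sub_cancel_left] at h2
      unfold content
      omega
    · have h1 := height_last (ε := ε) hrect (v := ((b : ℤ) - c, (b : ℤ))) (Or.inr rfl)
      have h2 := hh.right_eq hlam (b - c).toNat (by omega)
      rw [show (((b - c).toNat : ℕ) : ℤ) = b - c by omega,
        heq _ _ (by omega) (by omega) (by omega) le_rfl, h1] at h2
      unfold content at h2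
      simp only [sub_sub_cancel] at h2
      unfold content
      omega

/-- Points of positive level that increase in the total order and whose contents form the profile
of an oscillating tableau have positive coordinates: off the main diagonal, the neighbouring
diagonal must have been used before. -/
theorem one_le_of_profile (hq : IsQOrder q prec)
    (hs : ∀ k k', k < k' → Before q prec (s k) (s k')) (hlev : ∀ k, 1 ≤ level q (s k).1 (s k).2)
    {η : Fin (l + 1) → YoungDiagram} (hη : IsOscillating η)
    (hprof : ∀ i, profile η i = content (s i)) (k : Fin l) : 1 ≤ (s k).1 ∧ 1 ≤ (s k).2 := by
  induction k using WellFoundedLT.induction with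
  | ind k ih =>
    by_cases hz : profile η k = 0
    · have h1 := hlev k
      rw [hprof] at hz
      unfold content at hz
      unfold level at h1
      split_ifs at h1 <;> omega
    · obtain ⟨i, hik, hi⟩ := hη.exists_lt_profile k hz
      have h1 := ih i hik
      have h2 := before_asymm hq (hs i k hik)
      rw [hprof, hprof] at hi
      have h3 : ¬ ((s k).1 ≤ (s i).1 ∧ (s k).2 ≤ (s i).2) := by
        rintro ⟨h4, h5⟩
        by_cases he : s k = s i
        · exact h2 (he ▸ hs i k hik)
        · exact h2 (before_of_le_of_ne hq h4 h5 he)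
      rw [hprof] at hz
      unfold content at hi hz
      rcases lt_or_gt_of_ne hz with hneg | hpos
      · rw [Int.sign_eq_neg_one_of_neg hneg] at hi
        omega
      · rw [Int.sign_eq_one_of_pos hpos] at hi
        omega

end Correspondence

/-! ### The two mappings are inverse to each other -/

section Mappings

variable {q : ℤ} {prec : ℤ → ℤ → Prop} {l n : ℕ} {lam : YoungDiagram}

theorem level_le_iff {i j : ℤ} :
    level q i j ≤ n ↔ i ≤ aDim n q ∧ j ≤ bDim n q := by
  unfold level aDim bDim
  split_ifs <;> omega

theorem one_le_level {i j : ℤ} (h : 1 ≤ i ∧ 1 ≤ j) : 1 ≤ level q i j := by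
  unfold level
  split_ifs <;> omega

theorem mem_GOT_iff (hq : IsQOrder q prec) (x : (Fin l → ℤ) × (Fin (l + 1) → YoungDiagram)) :
    x ∈ GOT (Set.Icc 1 (n : ℤ)) prec lam l ↔ (∀ k, 1 ≤ x.1 k ∧ x.1 k ≤ n) ∧ x.2 ∈ OT lam l ∧
      ∀ k k', k < k' →
        Before q prec (G q (x.1 k) (profile x.2 k)) (G q (x.1 k') (profile x.2 k')) := by
  have := before_isStrictTotalOrder hq
  have hB : ∀ k k', Before q prec (G q (x.1 k) (profile x.2 k)) (G q (x.1 k') (profile x.2 k')) ↔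
      x.1 k < x.1 k' ∨ (x.1 k = x.1 k' ∧ prec (profile x.2 k) (profile x.2 k')) := by
    intro k k'
    unfold Before
    rw [level_G, level_G, content_G, content_G]
  refine and_congr_right fun _ => and_congr_right fun _ => ?_
  constructor
  · intro h k k' hk
    refine fin_lt_of_succ (r := Before q prec) (s := fun k => G q (x.1 k) (profile x.2 k))
      (fun _ _ _ => trans_of (Before q prec)) (fun k hk => ?_) hk
    rw [hB]
    rcases h k hk with h1 | ⟨h1, _, h2⟩
    · exact Or.inl h1
    · exact Or.inr ⟨h1, h2⟩
  · intro h k hk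
    rcases (hB _ _).1 (h k ⟨k + 1, hk⟩ (Fin.lt_def.2 (Nat.lt_succ_self _))) with h1 | ⟨h1, h2⟩
    · exact Or.inl h1
    · exact Or.inr ⟨h1, hk, h2⟩

theorem points_mem_rect (hq : IsQOrder q prec) {x : (Fin l → ℤ) × (Fin (l + 1) → YoungDiagram)}
    (hx : x ∈ GOT (Set.Icc 1 (n : ℤ)) prec lam l) (k : Fin l) :
    G q (x.1 k) (profile x.2 k) ∈ rect (aDim n q) (bDim n q) := by
  obtain ⟨h1, h2, h3⟩ := (mem_GOT_iff hq x).1 hx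
  have h4 := one_le_of_profile (s := fun k => G q (x.1 k) (profile x.2 k)) hq h3
    (fun k => by rw [level_G]; exact (h1 k).1) h2.1 (fun i => (content_G _ _ _).symm) k
  have h5 : level q (G q (x.1 k) (profile x.2 k)).1 (G q (x.1 k) (profile x.2 k)).2 ≤ n := by
    rw [level_G]; exact (h1 k).2
  rw [level_le_iff] at h5
  exact mem_rect_iff.2 ⟨h4.1, h5.1, h4.2, h5.2⟩

/-- The shape of an oscillating tableau fits into any rectangle that contains its points. -/
theorem mem_Par_of_points {a b : ℕ} {η : Fin (l + 1) → YoungDiagram} (hη : η ∈ OT lam l)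
    {s : Fin l → Point} (hprof : ∀ i, profile η i = content (s i)) (hrect : ∀ i, s i ∈ rect a b) :
    lam ∈ Par a b := by
  obtain ⟨ε, _, hN⟩ := hη.1.exists_signs
  have hex : ∀ i j : ℕ, (i, j) ∈ lam → ∃ k, content (s k) = (j : ℤ) - i := by
    intro i j hij
    by_contra! hc
    rw [mem_iff_lt_diagCount, ← hη.2, hN, partialCount_eq_zero] at hij
    · omega
    · intro k _
      rw [hprof]
      exact hc k
  constructor
  · by_contra hc
    have hm := YoungDiagram.mem_iff_lt_colLen.2 (show lam.colLen 0 - 1 < lam.colLen 0 by omega)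
    obtain ⟨k, hk⟩ := hex _ _ hm
    have := mem_rect_iff.1 (hrect k)
    unfold content at hk
    omega
  · by_contra hc
    have hm := YoungDiagram.mem_iff_lt_rowLen.2 (show lam.rowLen 0 - 1 < lam.rowLen 0 by omega)
    obtain ⟨k, hk⟩ := hex _ _ hm
    have := mem_rect_iff.1 (hrect k)
    unfold content at hk
    omega

theorem GOT_eq_empty (hq : IsQOrder q prec)
    (h : (n : ℤ) < level q (lam.colLen 0) (lam.rowLen 0)) :
    GOT (Set.Icc 1 (n : ℤ)) prec lam l = ∅ := by
  refine Set.eq_empty_iff_forall_notMem.2 fun x hx => ?_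
  have := mem_Par_of_points hx.2.1 (s := fun k => G q (x.1 k) (profile x.2 k))
    (fun i => (content_G _ _ _).symm) (points_mem_rect hq hx)
  refine absurd h (not_lt.2 (level_le_iff.2 ?_))
  exact ⟨by exact_mod_cast this.1, by exact_mod_cast this.2⟩

theorem inducedOrdering_eq (hq : IsQOrder q prec) {S : Finset Point} {s : Fin l → Point}
    (h : IsInducedOrdering (level q) prec S s) : inducedOrdering (level q) prec l S = s := by
  have := before_isStrictTotalOrder hq
  have h1 : IsInducedOrdering (level q) prec S (inducedOrdering (level q) prec l S) :=
    Classical.epsilon_spec (p := IsInducedOrdering (level q) prec S) ⟨s, h⟩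
  have hcard : S.card = l := by
    rw [← h.2.1, Finset.card_image_of_injective _ h.1, Finset.card_univ, Fintype.card_fin]
  exact (existsUnique_sorted (Before q prec) S hcard).unique
    ((isInducedOrdering_iff hq S _).1 h1) ((isInducedOrdering_iff hq S _).1 h)

theorem IsAssociatedTableau.unique {s : Fin l → Point} {η η' : Fin (l + 1) → YoungDiagram}
    (h : IsAssociatedTableau s η) (h' : IsAssociatedTableau s η') : η = η' :=
  h.1.ext h'.1 (funext fun k => by rw [h.2, h'.2])

theorem associatedTableau_eq {s : Fin l → Point} {η : Fin (l + 1) → YoungDiagram}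
    (h : IsAssociatedTableau s η) : associatedTableau s = η :=
  IsAssociatedTableau.unique (Classical.epsilon_spec (p := IsAssociatedTableau s) ⟨η, h⟩) h

theorem Theta_eq (hq : IsQOrder q prec) {S : Finset Point} {s : Fin l → Point}
    {η : Fin (l + 1) → YoungDiagram} (hs : IsInducedOrdering (level q) prec S s)
    (hη : IsAssociatedTableau s η) :
    Theta (level q) prec l S = (fun k => level q (s k).1 (s k).2, η) := by
  unfold Theta
  rw [inducedOrdering_eq hq hs, associatedTableau_eq hη]

theorem card_of_mem_VOS {a b : ℕ} {α β : Finset ℤ} {S : Finset Point} (h : S ∈ VOS a b α β l) :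
    S.card = l := by
  obtain ⟨P, _, h1, rfl⟩ := h
  exact h1

theorem mapsTo_Phi (hq : IsQOrder q prec) (hlam : lam ∈ Par (aDim n q) (bDim n q)) :
    Set.MapsTo (Phi q) (GOT (Set.Icc 1 (n : ℤ)) prec lam l)
      (VOS (aDim n q) (bDim n q) (alphaOf (aDim n q) (bDim n q) lam)
        (betaOf (aDim n q) (bDim n q) lam) l) := fun x hx =>
  image_mem_VOS hq ((mem_GOT_iff hq x).1 hx).2.2 (points_mem_rect hq hx) hlam hx.2.1
    fun _ => (content_G _ _ _).symm

/-- On a vacancy-osculation set, `Θ` is given by a listing of the points in the total order and an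
oscillating tableau of shape `λ`. -/
theorem exists_Theta_eq (hq : IsQOrder q prec) {a b : ℕ} (hlam : lam ∈ Par a b) {S : Finset Point}
    (hS : S ∈ VOS a b (alphaOf a b lam) (betaOf a b lam) l) :
    ∃ (s : Fin l → Point) (η : Fin (l + 1) → YoungDiagram),
      (∀ k k', k < k' → Before q prec (s k) (s k')) ∧ Finset.univ.image s = S ∧
      (∀ k, s k ∈ rect a b) ∧ η ∈ OT lam l ∧ (∀ k, profile η k = content (s k)) ∧
      Theta (level q) prec l S = (fun k => level q (s k).1 (s k).2, η) := by
  have := before_isStrictTotalOrder hq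
  obtain ⟨s, ⟨hs, himg⟩, _⟩ := existsUnique_sorted (Before q prec) S (card_of_mem_VOS hS)
  obtain ⟨hrect, η, hη, hprof⟩ := exists_tableau_of_mem_VOS hq hlam hS hs himg
  exact ⟨s, η, hs, himg, hrect, hη, hprof,
    Theta_eq hq ((isInducedOrdering_iff hq S s).2 ⟨hs, himg⟩) ⟨hη.1, hprof⟩⟩

theorem mapsTo_Theta (hq : IsQOrder q prec) (hlam : lam ∈ Par (aDim n q) (bDim n q)) :
    Set.MapsTo (Theta (level q) prec l)
      (VOS (aDim n q) (bDim n q) (alphaOf (aDim n q) (bDim n q) lam)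
        (betaOf (aDim n q) (bDim n q) lam) l)
      (GOT (Set.Icc 1 (n : ℤ)) prec lam l) := by
  intro S hS
  obtain ⟨s, η, hs, _, hrect, hη, hprof, he⟩ := exists_Theta_eq hq hlam hS
  rw [he, mem_GOT_iff hq]
  refine ⟨fun k => ?_, hη, fun k k' hk => ?_⟩
  · obtain ⟨r1, r2, r3, r4⟩ := mem_rect_iff.1 (hrect k)
    exact ⟨one_le_level ⟨r1, r3⟩, level_le_iff.2 ⟨r2, r4⟩⟩
  · simp only [hprof, G_level_content]
    exact hs k k' hk

theorem invOn_Theta_Phi (hq : IsQOrder q prec) (hlam : lam ∈ Par (aDim n q) (bDim n q)) :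
    Set.InvOn (Theta (level q) prec l) (Phi q) (GOT (Set.Icc 1 (n : ℤ)) prec lam l)
      (VOS (aDim n q) (bDim n q) (alphaOf (aDim n q) (bDim n q) lam)
        (betaOf (aDim n q) (bDim n q) lam) l) := by
  constructor
  · intro x hx
    have h1 := ((mem_GOT_iff hq x).1 hx).2.2
    have h2 : IsInducedOrdering (level q) prec (Phi q x)
        (fun k => G q (x.1 k) (profile x.2 k)) := (isInducedOrdering_iff hq _ _).2 ⟨h1, rfl⟩
    rw [Theta_eq hq h2 ⟨hx.2.1.1, fun k => (content_G _ _ _).symm⟩]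
    simp only [level_G]
  · intro S hS
    obtain ⟨s, η, _, himg, _, _, hprof, he⟩ := exists_Theta_eq hq hlam hS
    rw [he]
    unfold Phi
    simp only [hprof, G_level_content]
    exact himg

theorem Theta_wellDefined (hq : IsQOrder q prec) {a b : ℕ} (hlam : lam ∈ Par a b) {S : Finset Point}
    (hS : S ∈ VOS a b (alphaOf a b lam) (betaOf a b lam) l) :
    (∃! s : Fin l → Point, IsInducedOrdering (level q) prec S s) ∧
      ∀ s : Fin l → Point, IsInducedOrdering (level q) prec S s →
        ∃! η : Fin (l + 1) → YoungDiagram, IsAssociatedTableau s η := by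
  have := before_isStrictTotalOrder hq
  constructor
  · simp only [isInducedOrdering_iff hq]
    exact existsUnique_sorted (Before q prec) S (card_of_mem_VOS hS)
  · intro s hs
    obtain ⟨hs1, himg⟩ := (isInducedOrdering_iff hq S s).1 hs
    obtain ⟨_, η, hη, hprof⟩ := exists_tableau_of_mem_VOS hq hlam hS hs1 himg
    exact ⟨η, ⟨hη.1, hprof⟩, fun η' h => h.unique ⟨hη.1, hprof⟩⟩

end Mappings

/-! ### The distribution of the number of ascents -/

section Ascents

variable {l : ℕ} {lam : YoungDiagram}

theorem IsOscillating.abs_profile_le {η : Fin (l + 1) → YoungDiagram} (h : IsOscillating η)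
    (k : Fin l) : |profile η k| ≤ (k : ℕ) := by
  induction k using WellFoundedLT.induction with
  | ind k ih =>
    by_cases hz : profile η k = 0
    · rw [hz]; simp
    · obtain ⟨i, hik, hi⟩ := h.exists_lt_profile k hz
      have h1 := ih i hik
      rw [hi] at h1
      have h2 : (i : ℕ) < k := hik
      rw [abs_le] at h1 ⊢
      rcases lt_or_gt_of_ne hz with hneg | hpos
      · rw [Int.sign_eq_neg_one_of_neg hneg] at h1
        omega
      · rw [Int.sign_eq_one_of_pos hpos] at h1
        omega

theorem OT_finite (lam : YoungDiagram) (l : ℕ) : (OT lam l).Finite := by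
  refine Set.Finite.of_injOn (f := profile) (t := Set.univ.pi fun _ : Fin l => Set.Icc (-(l : ℤ)) l)
    ?_ (fun η hη η' hη' h => hη.1.ext hη'.1 h) (Set.Finite.pi fun _ => Set.finite_Icc _ _)
  intro η hη k _
  have h1 := hη.1.abs_profile_le k
  rw [abs_le] at h1
  have := k.isLt
  exact ⟨by omega, by omega⟩

/-- The strictly increasing sequences of length `l` with entries in `[m]`. -/
def strictSeqs (l m : ℕ) : Set (Fin l → ℤ) :=
  {u | (∀ k, u k ∈ Set.Icc 1 (m : ℤ)) ∧
    ∀ (k : Fin l) (h : (k : ℕ) + 1 < l), u k < u ⟨k + 1, h⟩}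

/-- The sequences of length `l` with entries in `[n]` that increase weakly at the positions in `A`
and strictly at the others. -/
def weakSeqs (l n : ℕ) (A : Set (Fin l)) : Set (Fin l → ℤ) :=
  {t | (∀ k, t k ∈ Set.Icc 1 (n : ℤ)) ∧
    ∀ (k : Fin l) (h : (k : ℕ) + 1 < l), t k < t ⟨k + 1, h⟩ ∨ (t k = t ⟨k + 1, h⟩ ∧ k ∈ A)}

theorem le_of_le_succ {v : Fin l → ℤ}
    (hv : ∀ (k : Fin l) (h : (k : ℕ) + 1 < l), v k ≤ v ⟨k + 1, h⟩) (k k' : Fin l) (h : k ≤ k') :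
    v k ≤ v k' := by
  rcases h.eq_or_lt with rfl | hlt
  · exact le_rfl
  · exact fin_lt_of_succ (r := (· ≤ ·)) (s := v) (fun _ _ _ => le_trans) hv hlt

theorem strictSeqs_bounds {m : ℕ} {u : Fin l → ℤ} (hu : u ∈ strictSeqs l m) (k : Fin l) :
    (k : ℕ) + 1 ≤ u k ∧ u k ≤ (k : ℕ) + 1 + m - l := by
  have hmono := le_of_le_succ (v := fun k => u k - (k : ℕ)) (fun k h => by
    have := hu.2 k h
    push_cast
    omega)
  have hk := k.isLt
  have h1 := hmono ⟨0, by omega⟩ k (Fin.le_def.2 (Nat.zero_le _))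
  have h2 := hmono k ⟨l - 1, by omega⟩ (Fin.le_def.2 (by simp only; omega))
  have h3 := (hu.1 ⟨0, by omega⟩).1
  have h4 := (hu.1 ⟨l - 1, by omega⟩).2
  simp only at h1 h2
  omega

theorem ncard_strictSeqs_of_lt {m : ℕ} (h : m < l) : (strictSeqs l m).ncard = 0 := by
  have : strictSeqs l m = ∅ := by
    refine Set.eq_empty_iff_forall_notMem.2 fun u hu => ?_
    have := strictSeqs_bounds hu ⟨0, by omega⟩
    omega
  rw [this, Set.ncard_empty]

theorem ncard_strictSeqs_self (l : ℕ) : (strictSeqs l l).ncard = 1 := by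
  rw [Set.ncard_eq_one]
  refine ⟨fun k => (k : ℕ) + 1, Set.ext fun u => ⟨fun hu => funext fun k => ?_, ?_⟩⟩
  · have := strictSeqs_bounds hu k
    omega
  · rintro rfl
    refine ⟨fun k => ?_, fun k h => by simp⟩
    have := k.isLt
    simp only [Set.mem_Icc]
    omega

/-- Adding to each entry the number of previous positions in `A` makes all increases strict. -/
theorem ncard_weakSeqs (n : ℕ) (A : Set (Fin l)) (hA : ∀ k ∈ A, (k : ℕ) + 1 < l) :
    (weakSeqs l n A).ncard = (strictSeqs l (n + A.ncard)).ncard := by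
  classical
  let d : Fin l → ℤ := fun k => ((Finset.univ.filter fun i : Fin l => i ∈ A ∧ i < k).card : ℕ)
  have hdA : ∀ k, 0 ≤ d k ∧ d k ≤ (A.ncard : ℕ) := by
    intro k
    refine ⟨by positivity, ?_⟩
    rw [Set.ncard_eq_toFinset_card']
    simp only [d]
    rw [Nat.cast_le]
    refine Finset.card_le_card fun i hi => ?_
    simp only [Finset.mem_filter] at hi
    exact Set.mem_toFinset.2 hi.2.1
  have hsucc : ∀ (k : Fin l) (h : (k : ℕ) + 1 < l),
      d ⟨k + 1, h⟩ = d k + if k ∈ A then 1 else 0 := by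
    intro k h
    simp only [d]
    have hiff : ∀ i : Fin l, i < (⟨k + 1, h⟩ : Fin l) ↔ i < k ∨ i = k := by
      intro i
      rw [Fin.lt_def, Fin.lt_def, Fin.ext_iff]
      simp only
      omega
    by_cases hk : k ∈ A
    · rw [if_pos hk]
      have : (Finset.univ.filter fun i : Fin l => i ∈ A ∧ i < (⟨k + 1, h⟩ : Fin l)) =
          insert k (Finset.univ.filter fun i : Fin l => i ∈ A ∧ i < k) := by
        ext i
        simp only [Finset.mem_filter, Finset.mem_univ, true_and, Finset.mem_insert, hiff]
        constructor
        · rintro ⟨h1, h2 | h2⟩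
          · exact Or.inr ⟨h1, h2⟩
          · exact Or.inl h2
        · rintro (rfl | ⟨h1, h2⟩)
          · exact ⟨hk, Or.inr rfl⟩
          · exact ⟨h1, Or.inl h2⟩
      rw [this, Finset.card_insert_of_notMem (by simp)]
      push_cast
      ring
    · rw [if_neg hk, add_zero]
      congr 2
      ext i
      simp only [Finset.mem_filter, Finset.mem_univ, true_and, hiff]
      constructor
      · rintro ⟨h1, h2 | h2⟩
        · exact ⟨h1, h2⟩
        · exact absurd (h2 ▸ h1) hk
      · rintro ⟨h1, h2⟩
        exact ⟨h1, Or.inl h2⟩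
  have hzero : ∀ h : 0 < l, d ⟨0, h⟩ = 0 := by
    intro h
    simp only [d]
    rw [Finset.filter_false_of_mem]
    · simp
    · rintro i - ⟨_, hi⟩
      exact absurd (Fin.lt_def.1 hi) (Nat.not_lt_zero _)
  have hlast : ∀ h : 0 < l, d ⟨l - 1, by omega⟩ = A.ncard := by
    intro h
    rw [Set.ncard_eq_toFinset_card']
    simp only [d]
    congr 2
    ext i
    simp only [Finset.mem_filter, Finset.mem_univ, true_and, Set.mem_toFinset,
      and_iff_left_iff_imp]
    intro hi
    have := hA i hi
    exact Fin.lt_def.2 (by simp only; omega)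
  refine Set.ncard_congr (fun t _ => fun k => t k + d k) ?_ ?_ ?_
  · rintro t ⟨h1, h2⟩
    refine ⟨fun k => ?_, fun k h => ?_⟩
    · have := h1 k
      have := hdA k
      rw [Set.mem_Icc] at *
      push_cast
      omega
    · simp only [hsucc k h]
      rcases h2 k h with h3 | ⟨h3, h4⟩
      · split_ifs <;> omega
      · rw [if_pos h4]; omega
  · intro t t' _ _ h
    funext k
    have := congrFun h k
    omega
  · rintro u ⟨h1, h2⟩
    have hstep : ∀ (k : Fin l) (h : (k : ℕ) + 1 < l), u k - d k < u ⟨k + 1, h⟩ - d ⟨k + 1, h⟩ ∨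
        (u k - d k = u ⟨k + 1, h⟩ - d ⟨k + 1, h⟩ ∧ k ∈ A) := by
      intro k h
      have := h2 k h
      rw [hsucc k h]
      by_cases hk : k ∈ A
      · simp only [hk, if_true, and_true]; omega
      · rw [if_neg hk]; omega
    have hmono := le_of_le_succ (v := fun k => u k - d k) (fun k h => by
      rcases hstep k h with h3 | h3
      · exact h3.le
      · exact h3.1.le)
    refine ⟨fun k => u k - d k, ⟨fun k => ?_, hstep⟩, funext fun k => sub_add_cancel _ _⟩
    have hk := k.isLt
    have e1 := hmono ⟨0, by omega⟩ k (Fin.le_def.2 (Nat.zero_le _))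
    have e2 := hmono k ⟨l - 1, by omega⟩ (Fin.le_def.2 (by simp only; omega))
    have e3 := (h1 ⟨0, by omega⟩).1
    have e4 := (h1 ⟨l - 1, by omega⟩).2
    rw [hzero (by omega)] at e1
    rw [hlast (by omega)] at e2
    push_cast at e4
    simp only [Set.mem_Icc]
    omega

theorem weakSeqs_finite (n : ℕ) (A : Set (Fin l)) : (weakSeqs l n A).Finite :=
  (Set.Finite.pi' fun _ => Set.finite_Icc 1 (n : ℤ)).subset fun _ ht => ht.1

theorem ncard_GOT [Fintype (OT lam l)] (prec : ℤ → ℤ → Prop) (n : ℕ) :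
    (GOT (Set.Icc 1 (n : ℤ)) prec lam l).ncard =
      ∑ η : OT lam l, (strictSeqs l (n + (ascents prec η.1).ncard)).ncard := by
  have e : GOT (Set.Icc 1 (n : ℤ)) prec lam l ≃
      Σ η : OT lam l, weakSeqs l n (ascents prec η.1) :=
    { toFun := fun x => ⟨⟨x.1.2, x.2.2.1⟩, ⟨x.1.1, x.2.1, x.2.2.2⟩⟩
      invFun := fun y => ⟨(y.2.1, y.1.1), y.2.2.1, y.1.2, y.2.2.2⟩
      left_inv := fun _ => rfl
      right_inv := fun _ => rfl }
  have : ∀ η : OT lam l, Finite (weakSeqs l n (ascents prec η.1)) := fun η =>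
    (weakSeqs_finite n _).to_subtype
  rw [← Nat.card_coe_set_eq, Nat.card_congr e, Nat.card_sigma]
  refine Finset.sum_congr rfl fun η _ => ?_
  rw [Nat.card_coe_set_eq, ncard_weakSeqs]
  rintro k ⟨h, _⟩
  exact h

/-- A distribution on `{0, …, l - 1}` is determined by its sums against the shifts of a function
that starts with a `1` at `l`: the resulting linear system is triangular. -/
theorem card_filter_eq_of_sum_eq {ι : Type*} [Fintype ι] {f g : ι → ℕ} {l : ℕ}
    (hf : ∀ x, f x < l) (hg : ∀ x, g x < l) {c : ℕ → ℕ} (h0 : ∀ m < l, c m = 0) (h1 : c l = 1)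
    (hsum : ∀ n, 0 < n → ∑ x, c (n + f x) = ∑ x, c (n + g x)) (i : ℕ) :
    (Finset.univ.filter fun x => f x = i).card = (Finset.univ.filter fun x => g x = i).card := by
  have hexp : ∀ (f : ι → ℕ), (∀ x, f x < l) → ∀ n, ∑ x, c (n + f x) =
      ∑ i ∈ Finset.range l, (Finset.univ.filter fun x => f x = i).card * c (n + i) := by
    intro f hf n
    rw [← Finset.sum_fiberwise_of_maps_to (g := f) (t := Finset.range l)
      (fun x _ => Finset.mem_range.2 (hf x))]
    refine Finset.sum_congr rfl fun i _ => ?_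
    rw [Finset.sum_congr rfl fun x hx => by rw [(Finset.mem_filter.1 hx).2], Finset.sum_const,
      smul_eq_mul]
  have key : ∀ d < l, (Finset.univ.filter fun x => f x = l - 1 - d).card =
      (Finset.univ.filter fun x => g x = l - 1 - d).card := by
    intro d
    induction d using Nat.strong_induction_on with
    | _ d ih =>
      intro hd
      have h := hsum (d + 1) (Nat.succ_pos d)
      rw [hexp f hf, hexp g hg] at h
      have hmem : l - 1 - d ∈ Finset.range l := Finset.mem_range.2 (by omega)
      rw [← Finset.add_sum_erase _ _ hmem, ← Finset.add_sum_erase _ _ hmem,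
        show d + 1 + (l - 1 - d) = l by omega, h1, mul_one, mul_one] at h
      rw [Finset.sum_congr rfl (g := fun i =>
        (Finset.univ.filter fun x => g x = i).card * c (d + 1 + i))] at h
      · exact Nat.add_right_cancel h
      · intro i hi
        obtain ⟨hne, hlt⟩ := Finset.mem_erase.1 hi
        rw [Finset.mem_range] at hlt
        rcases lt_or_gt_of_ne hne with h2 | h2
        · rw [h0 _ (by omega), mul_zero, mul_zero]
        · have := ih (l - 1 - i) (by omega) (by omega)
          rw [show l - 1 - (l - 1 - i) = i by omega] at this
          rw [this]
  by_cases hi : i < l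
  · have := key (l - 1 - i) (by omega)
    rwa [show l - 1 - (l - 1 - i) = i by omega] at this
  · rw [Finset.filter_false_of_mem fun x _ (h : f x = i) => hi (h ▸ hf x),
      Finset.filter_false_of_mem fun x _ (h : g x = i) => hi (h ▸ hg x)]

theorem ncard_ascents_lt (hl : 0 < l) (prec : ℤ → ℤ → Prop) (η : Fin (l + 1) → YoungDiagram) :
    (ascents prec η).ncard < l := by
  have : ascents prec η ⊂ Set.univ := by
    refine ⟨Set.subset_univ _, fun h => ?_⟩
    obtain ⟨h1, _⟩ := h (Set.mem_univ (⟨l - 1, by omega⟩ : Fin l))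
    simp only at h1
    omega
  have := Set.ncard_lt_ncard this
  rwa [Set.ncard_univ, Nat.card_fin] at this

theorem ascentDistribution_eq_of_ncard_GOT {prec prec' : ℤ → ℤ → Prop}
    (h : ∀ n : ℕ, 0 < n → (GOT (Set.Icc 1 (n : ℤ)) prec lam l).ncard =
      (GOT (Set.Icc 1 (n : ℤ)) prec' lam l).ncard) (i : ℕ) :
    ascentDistribution lam l prec i = ascentDistribution lam l prec' i := by
  rcases Nat.eq_zero_or_pos l with rfl | hl
  · unfold ascentDistribution
    have h0 : ∀ η : Fin (0 + 1) → YoungDiagram, ascents prec η = ascents prec' η :=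
      fun η => Subsingleton.elim _ _
    simp only [h0]
  · have := (OT_finite lam l).fintype
    have hd : ∀ prec : ℤ → ℤ → Prop, ascentDistribution lam l prec i =
        (Finset.univ.filter fun η : OT lam l => (ascents prec η.1).ncard = i).card := by
      intro prec
      unfold ascentDistribution
      rw [← Set.ncard_coe_finset, ← Set.ncard_image_of_injective _ Subtype.val_injective]
      congr 1
      ext η
      simp [and_comm]
    rw [hd, hd]
    refine card_filter_eq_of_sum_eq (f := fun η : OT lam l => (ascents prec η.1).ncard)
      (g := fun η : OT lam l => (ascents prec' η.1).ncard) (l := l)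
      (c := fun m => (strictSeqs l m).ncard)
      (fun η => ncard_ascents_lt hl prec η.1) (fun η => ncard_ascents_lt hl prec' η.1)
      (fun m hm => ncard_strictSeqs_of_lt hm) (ncard_strictSeqs_self l) (fun n hn => ?_) i
    exact (ncard_GOT prec n).symm.trans ((h n hn).trans (ncard_GOT prec' n))

end Ascents

/-- The number of generalized oscillating tableaux does not depend on the `q`-order, since the
vacancy-osculation sets do not. -/
theorem ncard_GOT_eq {q : ℤ} {prec prec' : ℤ → ℤ → Prop} (hq : IsQOrder q prec)
    (hq' : IsQOrder q prec') (lam : YoungDiagram) (l n : ℕ) :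
    (GOT (Set.Icc 1 (n : ℤ)) prec lam l).ncard = (GOT (Set.Icc 1 (n : ℤ)) prec' lam l).ncard := by
  by_cases h : level q (lam.colLen 0) (lam.rowLen 0) ≤ n
  · have hlam : lam ∈ Par (aDim n q) (bDim n q) := by
      have := level_le_iff.1 h
      exact ⟨by exact_mod_cast this.1, by exact_mod_cast this.2⟩
    have key : ∀ {prec : ℤ → ℤ → Prop}, IsQOrder q prec →
        (GOT (Set.Icc 1 (n : ℤ)) prec lam l).ncard = (VOS (aDim n q) (bDim n q)
          (alphaOf (aDim n q) (bDim n q) lam) (betaOf (aDim n q) (bDim n q) lam) l).ncard := by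
      intro prec hq
      have hbij := (invOn_Theta_Phi (l := l) hq hlam).bijOn (mapsTo_Phi hq hlam)
        (mapsTo_Theta hq hlam)
      rw [← hbij.image_eq, hbij.injOn.ncard_image]
    rw [key hq, key hq']
  · rw [GOT_eq_empty hq (not_le.1 h), GOT_eq_empty hq' (not_le.1 h)]

end Osculating

theorem theorem15 (n : ℕ) (hn : 0 < n) (q : ℤ) (prec : ℤ → ℤ → Prop)
    (hprec : Osculating.IsQOrder q prec) (lam : YoungDiagram) (l : ℕ) :
    -- emptiness for small `n`
    ((n : ℤ) < Osculating.level q (lam.colLen 0) (lam.rowLen 0) →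
      Osculating.GOT (Set.Icc 1 (n : ℤ)) prec lam l = ∅) ∧
    -- for the other `n`, with `(a, b) = (a(n,q), b(n,q))` and `(α, β)` corresponding to `λ`:
    (Osculating.level q (lam.colLen 0) (lam.rowLen 0) ≤ (n : ℤ) →
      ∀ (a b : ℕ) (α β : Finset ℤ), a = Osculating.aDim n q → b = Osculating.bDim n q →
      α = Osculating.alphaOf a b lam → β = Osculating.betaOf a b lam →
      -- the boundary point pair is well defined
      (lam ∈ Osculating.Par a b ∧ (α, β) ∈ Osculating.boundaryPairs a b) ∧
      -- `Φ_q` is a bijection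
      Set.BijOn (Osculating.Phi q)
        (Osculating.GOT (Set.Icc 1 (n : ℤ)) prec lam l) (Osculating.VOS a b α β l) ∧
      -- the mapping `Θ` is well defined on the vacancy-osculation sets
      (∀ S ∈ Osculating.VOS a b α β l,
        (∃! s : Fin l → Osculating.Point,
          Osculating.IsInducedOrdering (Osculating.level q) prec S s) ∧
        ∀ s : Fin l → Osculating.Point,
          Osculating.IsInducedOrdering (Osculating.level q) prec S s →
            ∃! η : Fin (l + 1) → YoungDiagram, Osculating.IsAssociatedTableau s η) ∧
      -- and it is the inverse of `Φ_q`
      Set.InvOn (Osculating.Theta (Osculating.level q) prec l) (Osculating.Phi q)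
        (Osculating.GOT (Set.Icc 1 (n : ℤ)) prec lam l) (Osculating.VOS a b α β l)) ∧
    -- the distribution of ascents does not depend on the `q`-order
    (Osculating.OT lam l).Finite ∧
    ∀ prec' : ℤ → ℤ → Prop, Osculating.IsQOrder q prec' → ∀ i : ℕ,
      Osculating.ascentDistribution lam l prec i = Osculating.ascentDistribution lam l prec' i := by
  have hpar : Osculating.level q (lam.colLen 0) (lam.rowLen 0) ≤ (n : ℤ) →
      lam ∈ Osculating.Par (Osculating.aDim n q) (Osculating.bDim n q) := by
    intro h
    have := Osculating.level_le_iff.1 h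
    exact ⟨by exact_mod_cast this.1, by exact_mod_cast this.2⟩
  refine ⟨Osculating.GOT_eq_empty hprec, ?_, Osculating.OT_finite lam l, fun prec' hprec' =>
    Osculating.ascentDistribution_eq_of_ncard_GOT fun n _ =>
      Osculating.ncard_GOT_eq hprec hprec' lam l n⟩
  rintro h a b α β rfl rfl rfl rfl
  have hlam := hpar h
  have hinv := Osculating.invOn_Theta_Phi (l := l) hprec hlam
  exact ⟨⟨hlam, Osculating.boundaryPair_mem hlam⟩,
    hinv.bijOn (Osculating.mapsTo_Phi hprec hlam) (Osculating.mapsTo_Theta hprec hlam),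
    fun S hS => Osculating.Theta_wellDefined hprec hlam hS, hinv⟩
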